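/- **Setting.** Let $\mathcal X$ be a measurable space, $\mathcal C\subseteq\{\pm1\}^{\mathcal X}$ a nonempty concept class, $\mathcal L=\mathcal X\times\{\pm1\}$. For $S\subseteq\mathcal L$ let $\mathcal V(S)=\{h\in\mathcal C: h(x)=y\ \forall (x,y)\in S\}$ (a *version space*), and for $V\subseteq\mathcal C$ let $V_{x\to l}=\{h\in V:h(x)=l\}$. A set $U\subseteq\mathcal L$ is *labeled by* $h$ if $h(x)=y$ for all $(x,y)\in U$, and *realizable in* $V$ if it is labeled by some $h\in V$. For $U\subseteq\mathcal L$ let $N(U)=\{x:\exists y,\ (x,y)\in U\}$. *Inference dimension.* Suppose each $h\in\mathcal C$ comes with $f_h:\mathcal X\to\mathbb R$ such that $h(x)=+1$ if $f_h(x)\ge 0$ and $h(x)=-1$ otherwise. For finite $S\subseteq\mathcal X$ the transcript $Q_h(S)$ consists of the values $\mathbf 1[f_h(x)\ge0]$ and $\mathbf 1[f_h(x)\ge f_h(x')]$ for $x,x'\in S$. The set $S\setminus\{x\}$ infers $x$ under $h$ if every $h'\in\mathcal C$ with $Q_{h'}(S\setminus\{x\})=Q_h(S\setminus\{x\})$ has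 $h'(x)=h(x)$. The inference dimension is the smallest $k$ such that for all $S\subseteq\mathcal X$ with $|S|=k$ and all $h\in\mathcal C$ some $x\in S$ is inferred by $S\setminus\{x\}$ under $h$. *Certificate dimension.* $\mathcal C$ has certificate dimension $k$ with parameters $(m,n)$, $m,n\ge1$, witnessed by $\sigma:\mathcal C\times\{U\subseteq\mathcal L:|U|=k-1\}\to\{0,\dots,n-1\}$, if for every $h\in\mathcal C$ and every $S\subseteq\mathcal L$ with $|S|=m$ labeled by $h$ there are $U\subseteq S$ with $|U|=k$ and $(x,y)\in U$ such that every $h'\in\mathcal V(S\setminus\{(x,y)\})$ with $\sigma(h',U\setminus\{(x,y)\})=\sigma(h,U\setminus\{(x,y)\})$ satisfies $h'(x)=h(x)=y$. *Good score functions.* A function $f(U;V)\in[0,c]$ of sets $U\subseteq\mathcal L$ with $|U|=j$ and version spaces $V$ is $(m,c,j)$-good if (i) $f(U;V)\ge f(U;V_{x\to y})$ whenever $U$ is realizable in $V_{x\to y}$; and (ii) for every $h\in\mathcal C$ and $M\subseteq\mathcal L$ with $|M|=m$ labeled by $h$ there are $U\subseteq M$ with $|U|=j$ and $(x,y)\in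 M\setminus U$ such that for every $A\supseteq M\setminus(U\cup\{(x,y)\})$ labeled by $h$, with $V=\mathcal V(A)$, either $f(U;V)-f(U;V_{x\to-y})\ge1$ or $U$ is not realizable in $V_{x\to-y}$. *Potential learner with score $f$ (on $j$-sets) and threshold $\alpha>0$.* Put $\rho_f(S)=\sum_{U\subseteq S,|U|=j}f(U;\mathcal V(S\setminus U))$. Given the finite set $S$ of labeled examples seen so far and the instance $x$, it predicts $-1$ if $\mathcal V(S)_{x\to+1}=\emptyset$; otherwise $+1$ if $\mathcal V(S)_{x\to-1}=\emptyset$; otherwise, with $\Delta_b=\rho_f(S)-\rho_f(S\cup\{(x,b)\})$, it predicts $-b^\star$ for a maximizer $b^\star$ of $\Delta_b$ (ties broken by an arbitrary rule depending on $S$ and $x$) if $\max_b\Delta_b\ge\alpha$, and it abstains ($\perp$) otherwise. *Adversarial injection model.* A distribution $\mathcal D$ on $\mathcal X$ and a target $c^\star\in\mathcal C$ are fixed. In round $t=1,\dots,T$ a (possibly randomized) adversary chooses, depending on the record of rounds $1,\dots,t-1$, a bit $q_t\in\{0,1\}$ and, if $q_t=1$, a point $x_t\in\mathcal X$; if $q_t=0$,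 then $x_t\sim\mathcal D$ is drawn independently of the past. The learner, which does not see $q_t$, outputs $\hat y_t\in\{\pm1,\perp\}$ and then sees $y_t=c^\star(x_t)$. It is understood that $q_t,\hat y_t,y_t$ are random variables, that is, measurable functions of the adversary's random seed and nature's draws. Let $err_{\mathrm{mis}}$ be the number of rounds with $\hat y_t\notin\{y_t,\perp\}$ and $err_{\mathrm{abs}}$ the number of rounds with $\hat y_t=\perp$ and $q_t=0$. **Lemma.** There are absolute constants $K,p$ such that the following holds. If $\mathcal C$ (with its real-valued representation) has inference dimension $k$, then for some $n\le 2^{k-1}k!$ there is $\sigma$ witnessing that $\mathcal C$ has certificate dimension $k$ with parameters $(m,n)=(k,n)$, and $\sigma$ encodes transcripts: for $|U|=k-1$ and $h,h'\in\mathcal C$, $\sigma(h,U)=\sigma(h',U)$ if and only if $Q_h(N(U))=Q_{h'}(N(U))$. Moreover, the score $f(U;V)=|\{\sigma(h,U):h\in V\}|$ is $(k,2^{k-1}k!,k-1)$-good, and for every $T\ge1$ there is $\alpha>0$ such that the potential learner with score $f$ and threshold $\alpha$ satisfies, for every $\mathcal D$, every $c^\star\in\mathcal C$ and every adversary, $$\mathbb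 E[err_{\mathrm{mis}}+err_{\mathrm{abs}}]\le K\,k\,T^{1-1/k}\,(1+\log T)^p,$$ that is, expected combined error $\tilde{O}(kT^{1-1/k})$. -/

import Mathlib

open MeasureTheory

universe u v

namespace AdversarialInjection

/-- A (potential) concept on the domain `X`; the label set `{±1}` is the group of units `ℤˣ`. -/
abbrev Concept (X : Type u) := X → ℤˣ

/-- The space `𝓛 = X × {±1}` of labeled examples. -/
abbrev Labeled (X : Type u) := X × ℤˣ

section VersionSpaces

variable {X : Type u}

/-- The labeled set `S` is labeled by `h` (all labels in `S` agree with `h`). -/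
def LabeledBy (h : Concept X) (S : Set (Labeled X)) : Prop :=
  ∀ z ∈ S, h z.1 = z.2

/-- The version space `𝓥(S)`. -/
def versionSpace (C : Set (Concept X)) (S : Set (Labeled X)) : Set (Concept X) :=
  {h | h ∈ C ∧ LabeledBy h S}

/-- The restriction `V_{x → l}`. -/
def restrict (V : Set (Concept X)) (x : X) (l : ℤˣ) : Set (Concept X) :=
  {h | h ∈ V ∧ h x = l}

/-- Membership in the family of all version spaces of `C`. -/
def IsVersionSpace (C : Set (Concept X)) (V : Set (Concept X)) : Prop :=
  ∃ S : Set (Labeled X), V = versionSpace C S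

/-- Some hypothesis in `V` is consistent with `U`. -/
def RealizableIn (V : Set (Concept X)) (U : Set (Labeled X)) : Prop :=
  ∃ h ∈ V, LabeledBy h U

end VersionSpaces

section InferenceDimension

variable {X : Type u}

/-- `sign r = +1` for `r ≥ 0` and `-1` for `r < 0`. -/
noncomputable def sgn (r : ℝ) : ℤˣ := if 0 ≤ r then 1 else -1

/-- `h ↦ F h` is a real-valued representation of the class `C`. -/
def IsRepresentation (C : Set (Concept X)) (F : Concept X → X → ℝ) : Prop :=
  ∀ h ∈ C, ∀ x, h x = sgn (F h x)

/-- The comparison-query transcript `Q_h(S)`: the answers to all queries `F h x ≥ 0` and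
`F h x ≥ F h x'` with `x, x' ∈ S`. -/
def transcript (F : Concept X → X → ℝ) (h : Concept X) (S : Finset X) :
    (S → Prop) × (S → S → Prop) :=
  (fun x => F h x ≥ 0, fun x x' => F h x ≥ F h x')

/-- `S` infers `x` under `h`. -/
def Infers (C : Set (Concept X)) (F : Concept X → X → ℝ) (S : Finset X) (x : X)
    (h : Concept X) : Prop :=
  ∀ h' ∈ C, transcript F h' S = transcript F h S → h' x = h x

open Classical in
/-- In every `k`-point set, under every `h ∈ C`, some point is inferred by the others. -/
def InferenceProperty (C : Set (Concept X)) (F : Concept X → X → ℝ) (k : ℕ) : Prop :=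
  ∀ S : Finset X, S.card = k → ∀ h ∈ C, ∃ x ∈ S, Infers C F (S.erase x) x h

/-- The inference dimension of `C` (with representation `F`) equals `k`. -/
def HasInferenceDimension (C : Set (Concept X)) (F : Concept X → X → ℝ) (k : ℕ) : Prop :=
  IsLeast {j | InferenceProperty C F j} k

end InferenceDimension

section CertificateDimension

variable {X : Type u}

open Classical in
/-- `N(U)`, the set of (unlabeled) points of a labeled set. -/
noncomputable def points (U : Finset (Labeled X)) : Finset X := U.image Prod.fst

open Classical in
/-- `σ` witnesses that `C` has certificate dimension `k` with parameters `(m, n)`.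
Only the values of `σ` at `h ∈ C` and at sets of size `k - 1` matter. -/
structure IsCertificate (C : Set (Concept X)) (k m n : ℕ)
    (σ : Concept X → Finset (Labeled X) → Fin n) : Prop where
  one_le_m : 1 ≤ m
  one_le_n : 1 ≤ n
  certifies : ∀ h ∈ C, ∀ S : Finset (Labeled X), S.card = m → LabeledBy h ↑S →
    ∃ U ⊆ S, U.card = k ∧ ∃ z ∈ U, ∀ h' ∈ versionSpace C ↑(S.erase z),
      σ h' (U.erase z) = σ h (U.erase z) → h' z.1 = h z.1 ∧ h z.1 = z.2

/-- On labeled sets of size `s`, the value `σ h U` is an encoding of the transcript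
`Q_h(N(U))`. -/
def EncodesTranscripts (C : Set (Concept X)) (F : Concept X → X → ℝ) (s : ℕ) {n : ℕ}
    (σ : Concept X → Finset (Labeled X) → Fin n) : Prop :=
  ∀ U : Finset (Labeled X), U.card = s → ∀ h ∈ C, ∀ h' ∈ C,
    (σ h U = σ h' U ↔ transcript F h (points U) = transcript F h' (points U))

/-- The score `f(U; V)`: the number of distinct certificate values `σ h U`, `h ∈ V`. -/
noncomputable def certificateScore {n : ℕ} (σ : Concept X → Finset (Labeled X) → Fin n)
    (U : Finset (Labeled X)) (V : Set (Concept X)) : ℝ :=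
  (((fun h => σ h U) '' V).ncard : ℝ)

end CertificateDimension

section PotentialFramework

variable {X : Type u}

open Classical in
/-- `f` is a score function with robustness window `m`, range `[0, c]` and subset size `k`:
it is bounded, monotone and `m`-robust. -/
structure IsGood (C : Set (Concept X)) (m : ℕ) (c : ℝ) (k : ℕ)
    (f : Finset (Labeled X) → Set (Concept X) → ℝ) : Prop where
  mem_Icc : ∀ U : Finset (Labeled X), U.card = k → ∀ V, IsVersionSpace C V →
    f U V ∈ Set.Icc 0 c
  mono : ∀ U : Finset (Labeled X), U.card = k → ∀ V, IsVersionSpace C V →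
    ∀ (x : X) (y : ℤˣ), RealizableIn (restrict V x y) ↑U → f U (restrict V x y) ≤ f U V
  robust : ∀ h ∈ C, ∀ M : Finset (Labeled X), M.card = m → LabeledBy h ↑M →
    ∃ U ⊆ M, U.card = k ∧ ∃ z ∈ M \ U, ∀ A : Set (Labeled X),
      ↑(M \ insert z U) ⊆ A → LabeledBy h A →
        f U (versionSpace C A) - f U (restrict (versionSpace C A) z.1 (-z.2)) ≥ 1 ∨
          ¬ RealizableIn (restrict (versionSpace C A) z.1 (-z.2)) ↑U

open Classical in
/-- The leave-`k`-out potential `ρ_f(S)`. -/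
noncomputable def potential (C : Set (Concept X)) (k : ℕ)
    (f : Finset (Labeled X) → Set (Concept X) → ℝ) (S : Finset (Labeled X)) : ℝ :=
  ∑ U ∈ S.powersetCard k, f U (versionSpace C ↑(S \ U))

open Classical in
/-- The one-step drop `Δ_b = ρ_f(S) - ρ_f(S ∪ {(x, b)})`. -/
noncomputable def drop (C : Set (Concept X)) (k : ℕ)
    (f : Finset (Labeled X) → Set (Concept X) → ℝ) (S : Finset (Labeled X)) (x : X)
    (b : ℤˣ) : ℝ :=
  potential C k f S - potential C k f (insert (x, b) S)

/-- A maximizer `b⋆` of `b ↦ Δ_b`; a tie is resolved by the rule `tie`. -/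
noncomputable def argmaxDrop (C : Set (Concept X)) (k : ℕ)
    (f : Finset (Labeled X) → Set (Concept X) → ℝ)
    (tie : Finset (Labeled X) → X → ℤˣ) (S : Finset (Labeled X)) (x : X) : ℤˣ :=
  if drop C k f S x (-1) < drop C k f S x 1 then 1
  else if drop C k f S x 1 < drop C k f S x (-1) then -1
  else tie S x

open Classical in
/-- The potential learner: its output on the instance `x` after the labeled set `S` has been
observed; `none` is the abstention `⊥`. -/
noncomputable def potentialLearner (C : Set (Concept X)) (k : ℕ)
    (f : Finset (Labeled X) → Set (Concept X) → ℝ) (α : ℝ)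
    (tie : Finset (Labeled X) → X → ℤˣ) (S : Finset (Labeled X)) (x : X) : Option ℤˣ :=
  if restrict (versionSpace C ↑S) x 1 = ∅ then some (-1)
  else if restrict (versionSpace C ↑S) x (-1) = ∅ then some 1
  else if max (drop C k f S x 1) (drop C k f S x (-1)) ≥ α then
    some (-(argmaxDrop C k f tie S x))
  else none

end PotentialFramework

section Protocol

variable {X : Type u} {R : Type v}

/-- The record of one round: hidden bit (`true` for an injected round, i.e. `q_t = 1`),
instance, prediction (`none` for abstention) and true label. -/
structure Round (X : Type u) where
  injected : Bool
  x : X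
  yhat : Option ℤˣ
  y : ℤˣ

/-- An adaptive adversary with internal randomness `r : R`: given `r` and the complete record
of the previous rounds it chooses the hidden bit and the instance used if it injects. -/
structure Adversary (R : Type v) (X : Type u) where
  bit : R → List (Round X) → Bool
  inject : R → List (Round X) → X

open Classical in
/-- The set of labeled examples seen in a history. -/
noncomputable def seen (hist : List (Round X)) : Finset (Labeled X) :=
  (hist.map fun ρ => (ρ.x, ρ.y)).toFinset

/-- One round of the protocol after the history `hist`; `w` is the draw of nature, used only
if the adversary does not inject. -/
noncomputable def playRound (learner : Finset (Labeled X) → X → Option ℤˣ) (cstar : Concept X)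
    (adv : Adversary R X) (r : R) (w : X) (hist : List (Round X)) :
    Round X :=
  let q := adv.bit r hist
  let x := if q then adv.inject r hist else w
  { injected := q, x := x, yhat := learner (seen hist) x, y := cstar x }

/-- The history after the first `t` rounds, when the adversary's seed is `p.1` and `p.2 t` is
the draw of nature in round `t` (rounds are numbered from `0`). -/
noncomputable def history (learner : Finset (Labeled X) → X → Option ℤˣ) (cstar : Concept X)
    (adv : Adversary R X) (p : R × (ℕ → X)) : ℕ → List (Round X)
  | 0 => []
  | t + 1 =>
    history learner cstar adv p t ++
      [playRound learner cstar adv p.1 (p.2 t) (history learner cstar adv p t)]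

/-- The record of round `t`. -/
noncomputable def roundAt (learner : Finset (Labeled X) → X → Option ℤˣ) (cstar : Concept X)
    (adv : Adversary R X) (t : ℕ) (p : R × (ℕ → X)) : Round X :=
  playRound learner cstar adv p.1 (p.2 t) (history learner cstar adv p t)

/-- The number of misclassifications in `T` rounds. -/
noncomputable def errMis (learner : Finset (Labeled X) → X → Option ℤˣ) (cstar : Concept X)
    (adv : Adversary R X) (T : ℕ) (p : R × (ℕ → X)) : ℝ :=
  ∑ t ∈ Finset.range T,
    let ρ := roundAt learner cstar adv t p
    if ρ.yhat ≠ some ρ.y ∧ ρ.yhat ≠ none then 1 else 0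

/-- The number of abstentions on i.i.d. rounds among `T` rounds. -/
noncomputable def errAbs (learner : Finset (Labeled X) → X → Option ℤˣ) (cstar : Concept X)
    (adv : Adversary R X) (T : ℕ) (p : R × (ℕ → X)) : ℝ :=
  ∑ t ∈ Finset.range T,
    let ρ := roundAt learner cstar adv t p
    if ρ.yhat = none ∧ ρ.injected = false then 1 else 0

variable [MeasurableSpace X] [MeasurableSpace R]

/-- The joint law of the adversary's seed (law `μ`) and of nature's draws, which are i.i.d.
with law `D` and independent of the seed. -/
noncomputable def law (μ : Measure R) (D : Measure X) [IsProbabilityMeasure D] :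
    Measure (R × (ℕ → X)) :=
  μ.prod (Measure.infinitePi fun _ : ℕ => D)

/-- In each of the first `T` rounds, the hidden bit, the prediction and the label are random
variables (as is implicit when one speaks of expected errors). -/
def IsMeasurableRun (learner : Finset (Labeled X) → X → Option ℤˣ) (cstar : Concept X)
    (adv : Adversary R X) (T : ℕ) : Prop :=
  ∀ t < T, Measurable[inferInstance, ⊤] fun p : R × (ℕ → X) =>
    ((roundAt learner cstar adv t p).injected, (roundAt learner cstar adv t p).yhat,
      (roundAt learner cstar adv t p).y)

end Protocol

end AdversarialInjection

open AdversarialInjection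

/-! A transcript on `k - 1` points is determined by the weak order of their values and `0`, that is,
by a sorting permutation of `k` numbers and the positions of the `k - 1` possible ties. This gives
at most `2 ^ (k - 1) * k!` codes. If the other points infer `x` under the target, flipping the label
of `x` removes the target's code from their version space. This one fact yields the certificate, the
robustness of the score and the error bound.

Misclassifications are bounded on every run. A wrong prediction means that the true label is the one
with the larger drop, so the potential falls by at least `α`. In any round it rises by at most `n *
choose t (k - 2)`, from the sets containing the new example. Summing, `α` times the number of
mistakes is at most `n * choose T (k - 1)`.

Abstentions are bounded in expectation. On an abstention the wrong label also has drop below `α`, so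
fewer than `β = α + n * choose T (k - 2)` sets of `k - 1` seen points infer the new one
(`card_infers_lt_of_abstain`). Keep only the earlier i.i.d. points. Among any `s + 1` draws, at most
`b` can be inferred so rarely by the others, because every `k`-set of such draws contains a point
inferred by the rest: `choose b k ≤ b * β` (`choose_card_rarelyInferred_le`). By exchangeability the
last draw is one of them with probability at most `b / (s + 1)`, and the harmonic sum gives the
logarithm.

The adversary's choice of i.i.d. rounds is adaptive, so "the `s`-th i.i.d. draw" needs care. For
each possible pattern of i.i.d. rounds the run is re-read with these rounds fed by consecutive
entries of a single stream, which preserves the law. The events of different patterns become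
disjoint events on this stream (`pattern_unique`). Taking `α` of order `(2 * y) ^ (k - 1)` with `y =
T ^ (1 - 1 / k)` balances both counts. -/

namespace AdversarialInjection

/-! ### Encoding transcripts; the certificate and the good score. -/

section Transcripts

variable {X : Type u}

/-- For a monotone sequence, `u i ≤ u j` with `j ≤ i` forces equality at every consecutive step
between, and these equalities carry over to `u'`. -/
theorem le_of_adjacent_eq {m : ℕ} {u u' : Fin (m + 1) → ℝ} (hu : Monotone u)
    (h : ∀ i : Fin m, u i.castSucc = u i.succ → u' i.castSucc = u' i.succ) (i j : Fin (m + 1))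
    (hji : j ≤ i) (hle : u i ≤ u j) : u' i ≤ u' j := by
  induction i using Fin.induction with
  | zero => rw [Fin.le_zero_iff.1 hji]
  | succ i ih =>
    rcases eq_or_lt_of_le hji with rfl | hlt
    · exact le_rfl
    · have hj : j ≤ i.castSucc := Fin.le_castSucc_iff.2 hlt
      have h1 : u i.castSucc ≤ u i.succ := hu (Fin.castSucc_le_succ i)
      have h2 : u j ≤ u i.castSucc := hu hj
      rw [← h i (le_antisymm h1 (hle.trans h2))]
      exact ih hj (h1.trans hle)

/-- A sorting permutation of a real vector, with the coincidences of consecutive sorted values. -/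
noncomputable def sortCode {m : ℕ} (g : Fin (m + 1) → ℝ) :
    Equiv.Perm (Fin (m + 1)) × (Fin m → Prop) :=
  (Tuple.sort g, fun i => g (Tuple.sort g i.castSucc) = g (Tuple.sort g i.succ))

theorem le_iff_le_of_sortCode_eq {m : ℕ} {g g' : Fin (m + 1) → ℝ}
    (h : sortCode g = sortCode g') (a b : Fin (m + 1)) : g a ≤ g b ↔ g' a ≤ g' b := by
  have hs : Tuple.sort g = Tuple.sort g' := congrArg Prod.fst h
  have hb : ∀ i : Fin m, (g ∘ Tuple.sort g) i.castSucc = (g ∘ Tuple.sort g) i.succ ↔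
      (g' ∘ Tuple.sort g) i.castSucc = (g' ∘ Tuple.sort g) i.succ := by
    intro i
    have := congrFun (congrArg Prod.snd h) i
    simp only [sortCode, ← hs, eq_iff_iff] at this
    exact this
  have hm : Monotone (g ∘ Tuple.sort g) := Tuple.monotone_sort g
  have hm' : Monotone (g' ∘ Tuple.sort g) := hs ▸ Tuple.monotone_sort g'
  have key : ∀ i j, (g ∘ Tuple.sort g) i ≤ (g ∘ Tuple.sort g) j ↔
      (g' ∘ Tuple.sort g) i ≤ (g' ∘ Tuple.sort g) j := by
    intro i j
    rcases le_total i j with hij | hji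
    · exact iff_of_true (hm hij) (hm' hij)
    · exact ⟨le_of_adjacent_eq hm (fun i => (hb i).1) i j hji,
        le_of_adjacent_eq hm' (fun i => (hb i).2) i j hji⟩
  simpa using key ((Tuple.sort g).symm a) ((Tuple.sort g).symm b)

/-- The transcripts of a set of at most `m` points can be numbered by `2 ^ m * (m + 1)!` numbers:
a transcript is a total preorder on the points together with the threshold `0`. -/
theorem exists_transcript_encoding (F : Concept X → X → ℝ) {m : ℕ} (P : Finset X)
    (hP : P.card ≤ m) :
    ∃ τ : Concept X → Fin (2 ^ m * (m + 1).factorial), ∀ h h',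
      τ h = τ h' ↔ transcript F h P = transcript F h' P := by
  classical
  have hcard : Fintype.card (Option P) ≤ Fintype.card (Fin (m + 1)) := by simpa using hP
  obtain ⟨e⟩ := Function.Embedding.nonempty_of_card_le hcard
  -- The extra index `none` carries the threshold `0`, so sign queries become comparisons.
  let val : Concept X → Option P → ℝ := fun h o => o.elim 0 (fun x => F h x)
  let g : Concept X → Fin (m + 1) → ℝ := fun h a => val h (Function.invFun e a)
  have hg : ∀ h o, g h (e o) = val h o := fun h o => by
    simp only [g, Function.leftInverse_invFun e.injective o]
  have hcode : ∀ h h', sortCode (g h) = sortCode (g h') →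
      transcript F h P = transcript F h' P := by
    intro h h' hc
    have hv : ∀ a b, val h a ≤ val h b ↔ val h' a ≤ val h' b := by
      intro a b
      have := le_iff_le_of_sortCode_eq hc (e a) (e b)
      simpa only [hg] using this
    refine Prod.ext (funext fun x => propext ?_) (funext fun x => funext fun x' => propext ?_)
    · exact hv none (some x)
    · exact hv (some x') (some x)
  -- The code is taken at a chosen representative of each transcript: equal transcripts need not
  -- have equal codes, since the sign query does not separate the value `0` from positive values.
  let c : Set.range (fun h => transcript F h P) → Equiv.Perm (Fin (m + 1)) × (Fin m → Prop) :=
    fun t => sortCode (g t.2.choose)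
  have hc : Function.Injective c := by
    intro t t' htt
    have := hcode _ _ htt
    apply Subtype.ext
    rw [← t.2.choose_spec, ← t'.2.choose_spec]
    exact this
  have hcardEq : Fintype.card (Equiv.Perm (Fin (m + 1)) × (Fin m → Prop)) =
      2 ^ m * (m + 1).factorial := by
    rw [Fintype.card_prod, Fintype.card_perm, Fintype.card_fun]
    simp [mul_comm]
  let E := Fintype.equivFinOfCardEq hcardEq
  refine ⟨fun h => E (c ⟨_, h, rfl⟩), fun h h' => ?_⟩
  rw [E.apply_eq_iff_eq, hc.eq_iff]
  exact Subtype.mk_eq_mk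

/-- A numbering of the transcripts of the point sets of labeled sets of size `s`. -/
theorem exists_encodesTranscripts (C : Set (Concept X)) (F : Concept X → X → ℝ) (s : ℕ) :
    ∃ σ : Concept X → Finset (Labeled X) → Fin (2 ^ s * (s + 1).factorial),
      EncodesTranscripts C F s σ := by
  classical
  have : ∀ U : Finset (Labeled X), ∃ τ : Concept X → Fin (2 ^ s * (s + 1).factorial),
      U.card = s → ∀ h h', τ h = τ h' ↔ transcript F h (points U) = transcript F h' (points U) := by
    intro U
    by_cases hU : U.card = s
    · obtain ⟨τ, hτ⟩ := exists_transcript_encoding F (points U)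
        (Finset.card_image_le.trans hU.le)
      exact ⟨τ, fun _ => hτ⟩
    · exact ⟨fun _ => ⟨0, by positivity⟩, fun h => absurd h hU⟩
  choose τ hτ using this
  exact ⟨fun h U => τ U h, fun U hU h _ h' _ => hτ U hU h h'⟩

open Classical in
theorem labeledBy_injOn {h : Concept X} {S : Finset (Labeled X)} (hS : LabeledBy h ↑S) :
    Set.InjOn Prod.fst (S : Set (Labeled X)) := by
  intro a ha b hb hab
  refine Prod.ext hab ?_
  rw [← hS a ha, ← hS b hb, hab]

open Classical in
theorem card_points {h : Concept X} {S : Finset (Labeled X)} (hS : LabeledBy h ↑S) :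
    (points S).card = S.card := Finset.card_image_of_injOn (labeledBy_injOn hS)

open Classical in
theorem points_erase {h : Concept X} {S : Finset (Labeled X)} (hS : LabeledBy h ↑S)
    {z : Labeled X} (hz : z ∈ S) : points (S.erase z) = (points S).erase z.1 := by
  ext x
  simp only [points, Finset.mem_image, Finset.mem_erase]
  constructor
  · rintro ⟨w, ⟨hwz, hw⟩, rfl⟩
    exact ⟨fun h' => hwz (labeledBy_injOn hS hw hz h'), w, hw, rfl⟩
  · rintro ⟨hx, w, hw, rfl⟩
    exact ⟨w, ⟨fun h' => hx (by rw [h']), hw⟩, rfl⟩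

open Classical in
theorem InferenceProperty.exists_infers {C : Set (Concept X)} {F : Concept X → X → ℝ} {k : ℕ}
    (hI : InferenceProperty C F k) {h : Concept X} (hh : h ∈ C) {S : Finset (Labeled X)}
    (hcard : S.card = k) (hS : LabeledBy h ↑S) :
    ∃ z ∈ S, Infers C F (points (S.erase z)) z.1 h := by
  obtain ⟨x, hx, hinf⟩ := hI (points S) ((card_points hS).trans hcard) h hh
  obtain ⟨z, hz, rfl⟩ := Finset.mem_image.1 hx
  exact ⟨z, hz, by rwa [points_erase hS hz]⟩

theorem EncodesTranscripts.isCertificate {C : Set (Concept X)} {F : Concept X → X → ℝ} {k n : ℕ}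
    (hI : InferenceProperty C F k) (hk : 1 ≤ k) (hn : 1 ≤ n)
    {σ : Concept X → Finset (Labeled X) → Fin n} (hσ : EncodesTranscripts C F (k - 1) σ) :
    IsCertificate C k k n σ where
  one_le_m := hk
  one_le_n := hn
  certifies h hh S hcard hS := by
    classical
    obtain ⟨z, hz, hinf⟩ := hI.exists_infers hh hcard hS
    -- As `m = k`, the whole sample serves as `U`.
    refine ⟨S, subset_rfl, hcard, z, hz, fun h' hh' heq => ⟨hinf h' hh'.1 ?_, hS z hz⟩⟩
    refine (hσ _ ?_ h' hh'.1 h hh).1 (by convert heq)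
    rw [Finset.card_erase_of_mem hz, hcard]

theorem certificateScore_mono {n : ℕ} (σ : Concept X → Finset (Labeled X) → Fin n)
    (U : Finset (Labeled X)) {V W : Set (Concept X)} (h : V ⊆ W) :
    certificateScore σ U V ≤ certificateScore σ U W :=
  Nat.cast_le.2 (Set.ncard_le_ncard (Set.image_mono h) (Set.toFinite _))

theorem certificateScore_nonneg {n : ℕ} (σ : Concept X → Finset (Labeled X) → Fin n)
    (U : Finset (Labeled X)) (V : Set (Concept X)) : 0 ≤ certificateScore σ U V :=
  Nat.cast_nonneg _

theorem certificateScore_le {n : ℕ} (σ : Concept X → Finset (Labeled X) → Fin n)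
    (U : Finset (Labeled X)) (V : Set (Concept X)) : certificateScore σ U V ≤ n := by
  refine Nat.cast_le.2 ((Set.ncard_le_ncard (Set.subset_univ _) (Set.toFinite _)).trans ?_)
  rw [Set.ncard_univ, Nat.card_fin]

theorem restrict_subset (V : Set (Concept X)) (x : X) (l : ℤˣ) : restrict V x l ⊆ V :=
  fun _ h => h.1

theorem units_neg_ne (y : ℤˣ) : -y ≠ y := by
  rcases Int.units_eq_one_or y with rfl | rfl <;> decide

/-- An inferring set loses a certificate value when the label of the inferred point is flipped. -/
theorem certificateScore_restrict_add_one_le {C : Set (Concept X)} {F : Concept X → X → ℝ}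
    {s n : ℕ} {σ : Concept X → Finset (Labeled X) → Fin n} (hσ : EncodesTranscripts C F s σ)
    {h : Concept X} {U : Finset (Labeled X)} (hU : U.card = s) {x : X}
    (hinf : Infers C F (points U) x h) {V : Set (Concept X)} (hV : V ⊆ C) (hh : h ∈ V) :
    certificateScore σ U (restrict V x (-h x)) + 1 ≤ certificateScore σ U V := by
  have hlt : ((fun h => σ h U) '' restrict V x (-h x)) ⊂ (fun h => σ h U) '' V := by
    refine Set.ssubset_iff_of_subset (Set.image_mono (restrict_subset _ _ _)) |>.2
      ⟨σ h U, ⟨h, hh, rfl⟩, ?_⟩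
    -- The code of `h` itself is lost: a concept sharing it has the same transcript, hence the
    -- inferred label at `x`.
    rintro ⟨h', ⟨hV', hx'⟩, heq⟩
    have := hinf h' (hV hV') ((hσ U hU h' (hV hV') h (hV hh)).1 heq)
    exact units_neg_ne (h x) (hx'.symm.trans this)
  have := Set.ncard_lt_ncard hlt (Set.toFinite _)
  unfold certificateScore
  exact_mod_cast this

theorem versionSpace_subset (C : Set (Concept X)) (S : Set (Labeled X)) : versionSpace C S ⊆ C :=
  fun _ h => h.1

theorem EncodesTranscripts.isGood {C : Set (Concept X)} {F : Concept X → X → ℝ} {k n : ℕ}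
    (hI : InferenceProperty C F k)
    {σ : Concept X → Finset (Labeled X) → Fin n} (hσ : EncodesTranscripts C F (k - 1) σ) :
    IsGood C k n (k - 1) (certificateScore σ) where
  mem_Icc U _ V _ := ⟨certificateScore_nonneg σ U V, certificateScore_le σ U V⟩
  mono U _ V _ x y _ := certificateScore_mono σ U (restrict_subset V x y)
  robust h hh M hcard hM := by
    classical
    obtain ⟨z, hz, hinf⟩ := hI.exists_infers hh hcard hM
    have hU : (M.erase z).card = k - 1 := by rw [Finset.card_erase_of_mem hz, hcard]
    -- With `|M| = k` the set `U` is all of `M` but the inferred example, and the score always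
    -- drops, so the unrealizable alternative is not needed.
    refine ⟨M.erase z, Finset.erase_subset _ _, hU, z, by simp [hz], fun A _ hA => Or.inl ?_⟩
    have hinf' : Infers C F (points (M.erase z)) z.1 h := by convert hinf
    have := certificateScore_restrict_add_one_le hσ hU hinf' (versionSpace_subset C A)
      (⟨hh, hA⟩ : h ∈ versionSpace C A)
    rw [hM z hz] at this
    linarith

end Transcripts

/-! ### How the potential changes when an example is added. -/

section Potential

variable {X : Type u}

open Classical in
theorem potential_nonneg (C : Set (Concept X)) (k : ℕ) {n : ℕ}
    (σ : Concept X → Finset (Labeled X) → Fin n) (S : Finset (Labeled X)) :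
    0 ≤ potential C k (certificateScore σ) S :=
  Finset.sum_nonneg fun _ _ => certificateScore_nonneg _ _ _

open Classical in
theorem versionSpace_insert_sdiff (C : Set (Concept X)) {S U : Finset (Labeled X)}
    {z : Labeled X} (hz : z ∉ U) :
    versionSpace C ↑(insert z S \ U) = restrict (versionSpace C ↑(S \ U)) z.1 z.2 := by
  rw [Finset.insert_sdiff_of_notMem _ hz]
  ext h
  simp only [versionSpace, restrict, LabeledBy, Set.mem_ofPred_eq, Finset.mem_coe,
    Finset.forall_mem_insert]
  tauto

open Classical in
/-- Adding a labeled example restricts the version spaces in the old terms of the potential; the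
new terms are bounded trivially. -/
theorem potential_insert_le (C : Set (Concept X)) (i : ℕ) {n : ℕ}
    (σ : Concept X → Finset (Labeled X) → Fin n) {S : Finset (Labeled X)} {z : Labeled X}
    (hz : z ∉ S) :
    potential C (i + 1) (certificateScore σ) (insert z S) ≤
      ∑ U ∈ S.powersetCard (i + 1),
        certificateScore σ U (restrict (versionSpace C ↑(S \ U)) z.1 z.2) +
      n * S.card.choose i := by
  unfold potential
  rw [Finset.powersetCard_succ_insert hz, Finset.sum_union]
  · refine add_le_add (le_of_eq (Finset.sum_congr rfl fun U hU => ?_)) ?_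
    · rw [versionSpace_insert_sdiff C fun h => hz ((Finset.mem_powersetCard.1 hU).1 h)]
    · refine (Finset.sum_le_card_nsmul _ _ (n : ℝ) fun U _ => certificateScore_le _ _ _).trans ?_
      rw [nsmul_eq_mul, mul_comm]
      refine mul_le_mul_of_nonneg_left (Nat.cast_le.2 ?_) (Nat.cast_nonneg _)
      exact Finset.card_image_le.trans (Finset.card_powersetCard _ _).le
  · rw [Finset.disjoint_left]
    intro U hU hU'
    obtain ⟨W, -, rfl⟩ := Finset.mem_image.1 hU'
    exact hz ((Finset.mem_powersetCard.1 hU).1 (Finset.mem_insert_self _ _))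

open Classical in
theorem potential_insert_le_add (C : Set (Concept X)) (i : ℕ) {n : ℕ}
    (σ : Concept X → Finset (Labeled X) → Fin n) (S : Finset (Labeled X)) (z : Labeled X) :
    potential C (i + 1) (certificateScore σ) (insert z S) ≤
      potential C (i + 1) (certificateScore σ) S + n * S.card.choose i := by
  by_cases hz : z ∈ S
  · rw [Finset.insert_eq_of_mem hz]
    exact le_add_of_nonneg_right (by positivity)
  · refine (potential_insert_le C i σ hz).trans (add_le_add_left (Finset.sum_le_sum fun U _ => ?_) _)
    exact certificateScore_mono σ U (restrict_subset _ _ _)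

open Classical in
/-- The number of `s`-sets of points that infer `x` is at most the drop of the potential under
the wrong label, up to the trivial bound on the new terms. -/
theorem card_infers_le_drop {C : Set (Concept X)} {F : Concept X → X → ℝ} {i n : ℕ}
    {σ : Concept X → Finset (Labeled X) → Fin n} (hσ : EncodesTranscripts C F (i + 1) σ)
    {c : Concept X} (hc : c ∈ C) {S : Finset (Labeled X)} (hS : LabeledBy c ↑S) {x : X}
    (hx : x ∉ points S) {P : Finset X} (hP : P ⊆ points S) :
    (((P.powersetCard (i + 1)).filter fun Q => Infers C F Q x c).card : ℝ) ≤
      drop C (i + 1) (certificateScore σ) S x (-c x) + n * S.card.choose i := by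
  have hz : (x, -c x) ∉ S := fun h => hx (Finset.mem_image.2 ⟨_, h, rfl⟩)
  set G := (S.powersetCard (i + 1)).filter fun U => Infers C F (points U) x c with hG
  have hpts : ∀ Q : Finset X, points (Q.image fun x => (x, c x)) = Q := fun Q => by
    ext a; simp [points]
  have hcard : ((P.powersetCard (i + 1)).filter fun Q => Infers C F Q x c).card ≤ G.card := by
    -- Labeling points by `c` turns inferring point sets into inferring subsets of `S`.
    refine Finset.card_le_card_of_injOn (fun Q => Q.image fun x => (x, c x)) ?_ ?_
    · intro Q hQ
      simp only [Finset.coe_filter, Set.mem_ofPred_eq, Finset.mem_powersetCard] at hQ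
      simp only [hG, Finset.coe_filter, Set.mem_ofPred_eq, Finset.mem_powersetCard]
      refine ⟨⟨?_, ?_⟩, by rw [hpts]; exact hQ.2⟩
      · intro z hz'
        obtain ⟨a, ha, rfl⟩ := Finset.mem_image.1 hz'
        obtain ⟨w, hw, hwa⟩ := Finset.mem_image.1 (hP (hQ.1.1 ha))
        have : w = (a, c a) := Prod.ext hwa (by rw [← hS w hw, hwa])
        exact this ▸ hw
      · rw [Finset.card_image_of_injective _ fun a b hab => (Prod.mk.inj hab).1, hQ.1.2]
    · intro Q _ Q' _ h
      have := congrArg points h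
      rwa [hpts, hpts] at this
  have hsum : ∑ U ∈ S.powersetCard (i + 1),
        certificateScore σ U (restrict (versionSpace C ↑(S \ U)) x (-c x)) + G.card ≤
      potential C (i + 1) (certificateScore σ) S := by
    unfold potential
    rw [hG, Finset.card_filter, Nat.cast_sum, ← Finset.sum_add_distrib]
    refine Finset.sum_le_sum fun U hU => ?_
    split_ifs with hinf
    · rw [Nat.cast_one]
      refine certificateScore_restrict_add_one_le hσ (Finset.mem_powersetCard.1 hU).2 hinf
        (versionSpace_subset C _) ⟨hc, fun z hz => hS z ?_⟩
      exact Finset.mem_coe.2 (Finset.sdiff_subset (Finset.mem_coe.1 hz))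
    · rw [Nat.cast_zero, add_zero]
      exact certificateScore_mono σ U (restrict_subset _ _ _)
  have := potential_insert_le C i σ hz
  have hcard' := Nat.cast_le (α := ℝ).2 hcard
  unfold drop
  linarith

end Potential

/-! ### What a mistake and an abstention say about the potential. -/

section Learner

variable {X : Type u}

open Classical in
theorem drop_argmaxDrop (C : Set (Concept X)) (k : ℕ)
    (f : Finset (Labeled X) → Set (Concept X) → ℝ) (tie : Finset (Labeled X) → X → ℤˣ)
    (S : Finset (Labeled X)) (x : X) :
    drop C k f S x (argmaxDrop C k f tie S x) = max (drop C k f S x 1) (drop C k f S x (-1)) := by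
  unfold argmaxDrop
  split_ifs with h1 h2
  · rw [max_eq_left h1.le]
  · rw [max_eq_right h2.le]
  · have : drop C k f S x 1 = drop C k f S x (-1) := le_antisymm (not_lt.1 h1) (not_lt.1 h2)
    rcases Int.units_eq_one_or (tie S x) with h | h <;> simp [h, this]

theorem units_eq_of_neg_ne {a b : ℤˣ} (h : -a ≠ b) : a = b := by
  rcases Int.units_eq_one_or a with rfl | rfl <;> rcases Int.units_eq_one_or b with rfl | rfl <;>
    simp_all

open Classical in
/-- A misclassification decreases the potential by the threshold. -/
theorem potential_insert_le_sub_of_mistake {C : Set (Concept X)} {k : ℕ}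
    {f : Finset (Labeled X) → Set (Concept X) → ℝ} {α : ℝ} {tie : Finset (Labeled X) → X → ℤˣ}
    {S : Finset (Labeled X)} {x : X} {c : Concept X} (hc : c ∈ C) (hS : LabeledBy c ↑S)
    (h1 : potentialLearner C k f α tie S x ≠ some (c x))
    (h2 : potentialLearner C k f α tie S x ≠ none) :
    potential C k f (insert (x, c x) S) ≤ potential C k f S - α := by
  have hcV : c ∈ restrict (versionSpace C ↑S) x (c x) := ⟨⟨hc, hS⟩, rfl⟩
  unfold potentialLearner at h1 h2
  -- Predictions forced by an empty version space are never wrong, since `c` is consistent with `S`.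
  split_ifs at h1 h2 with he1 he2 hα
  · exfalso
    rcases Int.units_eq_one_or (c x) with h | h
    · rw [h, he1] at hcV; exact hcV
    · exact h1 (by rw [h])
  · exfalso
    rcases Int.units_eq_one_or (c x) with h | h
    · exact h1 (by rw [h])
    · rw [h, he2] at hcV; exact hcV
  -- The prediction is the negated maximizer, so when it is wrong the maximizer is the true label.
  · have harg := units_eq_of_neg_ne fun h => h1 (congrArg some h)
    have := drop_argmaxDrop C k f tie S x
    rw [harg] at this
    rw [← this] at hα
    unfold drop at hα
    linarith
  · exact absurd rfl h2

open Classical in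
theorem notMem_points_of_restrict_ne_empty {C : Set (Concept X)} {S : Finset (Labeled X)} {x : X}
    (h1 : restrict (versionSpace C ↑S) x 1 ≠ ∅) (h2 : restrict (versionSpace C ↑S) x (-1) ≠ ∅) :
    x ∉ points S := by
  intro hx
  obtain ⟨z, hz, rfl⟩ := Finset.mem_image.1 hx
  obtain ⟨h, hh, hh1⟩ := Set.nonempty_iff_ne_empty.2 h1
  obtain ⟨h', hh', hh1'⟩ := Set.nonempty_iff_ne_empty.2 h2
  have e1 := hh.2 z hz
  have e2 := hh'.2 z hz
  rw [hh1] at e1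
  rw [hh1', ← e1] at e2
  exact units_neg_ne 1 e2

open Classical in
theorem drop_lt_of_abstain {C : Set (Concept X)} {k : ℕ}
    {f : Finset (Labeled X) → Set (Concept X) → ℝ} {α : ℝ} {tie : Finset (Labeled X) → X → ℤˣ}
    {S : Finset (Labeled X)} {x : X}
    (h : potentialLearner C k f α tie S x = none) :
    x ∉ points S ∧ ∀ b, drop C k f S x b < α := by
  unfold potentialLearner at h
  split_ifs at h with he1 he2 hα
  refine ⟨notMem_points_of_restrict_ne_empty he1 he2, fun b => ?_⟩
  have := max_lt_iff.1 (not_le.1 hα)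
  rcases Int.units_eq_one_or b with rfl | rfl
  exacts [this.1, this.2]

end Learner

/-! ### Accounting along a run. -/

section Runs

variable {X : Type u} {R : Type v}

open Classical in
theorem seen_append (l : List (Round X)) (ρ : Round X) :
    seen (l ++ [ρ]) = insert (ρ.x, ρ.y) (seen l) := by
  ext z
  simp only [seen, List.map_append, List.map_cons, List.map_nil, List.toFinset_append,
    Finset.mem_union, Finset.mem_insert, List.mem_toFinset, List.mem_singleton]
  tauto

variable (learner : Finset (Labeled X) → X → Option ℤˣ) (c : Concept X) (adv : Adversary R X)
  (p : R × (ℕ → X))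

open Classical in
theorem seen_history_succ (t : ℕ) : seen (history learner c adv p (t + 1)) =
    insert ((roundAt learner c adv t p).x, c (roundAt learner c adv t p).x)
      (seen (history learner c adv p t)) :=
  seen_append _ _

open Classical in
theorem labeledBy_seen (t : ℕ) : LabeledBy c ↑(seen (history learner c adv p t)) := by
  induction t with
  | zero => simp [LabeledBy, history, seen]
  | succ t ih =>
    rw [seen_history_succ]
    intro z hz
    rcases Finset.mem_insert.1 (Finset.mem_coe.1 hz) with rfl | hz
    · rfl
    · exact ih z hz

theorem card_seen_le (t : ℕ) : (seen (history learner c adv p t)).card ≤ t := by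
  classical
  induction t with
  | zero => simp [history, seen]
  | succ t ih =>
    rw [seen_history_succ]
    exact (Finset.card_insert_le _ _).trans (Nat.succ_le_succ ih)

open Classical in
theorem mem_points_seen {s t : ℕ} (hst : s < t) :
    (roundAt learner c adv s p).x ∈ points (seen (history learner c adv p t)) := by
  induction t with
  | zero => omega
  | succ t ih =>
    rw [seen_history_succ, points, Finset.image_insert]
    rcases Nat.lt_succ_iff_lt_or_eq.1 hst with h | rfl
    · exact Finset.mem_insert_of_mem (ih h)
    · exact Finset.mem_insert_self _ _

open Classical in
/-- The potential pays for the misclassifications. -/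
theorem potential_add_errMis_le {C : Set (Concept X)} {i n : ℕ}
    (σ : Concept X → Finset (Labeled X) → Fin n) (α : ℝ) (tie : Finset (Labeled X) → X → ℤˣ)
    (hc : c ∈ C) (T : ℕ) :
    potential C (i + 1) (certificateScore σ) (seen (history
        (potentialLearner C (i + 1) (certificateScore σ) α tie) c adv p T)) +
      α * errMis (potentialLearner C (i + 1) (certificateScore σ) α tie) c adv T p ≤
      n * T.choose (i + 1) := by
  set L := potentialLearner C (i + 1) (certificateScore σ) α tie with hL
  induction T with
  | zero =>
    have : (∅ : Finset (Labeled X)).powersetCard (i + 1) = ∅ :=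
      Finset.powersetCard_eq_empty.2 (by simp)
    simp [errMis, potential, history, seen, this]
  | succ t ih =>
    set S := seen (history L c adv p t) with hSdef
    have hS : LabeledBy c ↑S := labeledBy_seen L c adv p t
    have hcard : ((S.card.choose i : ℕ) : ℝ) ≤ (t.choose i : ℕ) :=
      Nat.cast_le.2 (Nat.choose_le_choose i (card_seen_le L c adv p t))
    have hn : (n : ℝ) * S.card.choose i ≤ n * t.choose i :=
      mul_le_mul_of_nonneg_left hcard (Nat.cast_nonneg _)
    have herr : errMis L c adv (t + 1) p = errMis L c adv t p +
        (if (roundAt L c adv t p).yhat ≠ some (roundAt L c adv t p).y ∧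
          (roundAt L c adv t p).yhat ≠ none then 1 else 0) := by
      simp only [errMis, Finset.sum_range_succ]
    -- Pascal's rule: the increase `n * choose t i` of the bound pays for the new terms. In a
    -- mistake round the decrease by `α` already includes them.
    rw [herr, seen_history_succ, ← hSdef, Nat.choose_succ_succ', Nat.cast_add, mul_add, mul_add]
    set x := (roundAt L c adv t p).x
    split_ifs with hm
    · have hstep := potential_insert_le_sub_of_mistake (x := x) hc hS (hL ▸ hm.1) (hL ▸ hm.2)
      have : (0 : ℝ) ≤ n * t.choose i := by positivity
      linarith
    · have hstep := potential_insert_le_add C i σ S (x, c x)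
      linarith

open Classical in
/-- If the learner abstains, few sets of seen points infer the current instance. -/
theorem card_infers_lt_of_abstain {C : Set (Concept X)} {F : Concept X → X → ℝ} {i n : ℕ}
    {σ : Concept X → Finset (Labeled X) → Fin n} (hσ : EncodesTranscripts C F (i + 1) σ)
    {α : ℝ} {tie : Finset (Labeled X) → X → ℤˣ} (hc : c ∈ C) {t T : ℕ} (htT : t ≤ T)
    (habs : (roundAt (potentialLearner C (i + 1) (certificateScore σ) α tie) c adv t p).yhat = none)
    {P : Finset X} (hP : P ⊆ points (seen (history
      (potentialLearner C (i + 1) (certificateScore σ) α tie) c adv p t))) :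
    (roundAt (potentialLearner C (i + 1) (certificateScore σ) α tie) c adv t p).x ∉ P ∧
    (((P.powersetCard (i + 1)).filter fun Q => Infers C F Q
      (roundAt (potentialLearner C (i + 1) (certificateScore σ) α tie) c adv t p).x c).card : ℝ) <
      α + n * T.choose i := by
  obtain ⟨hx, hdrop⟩ := drop_lt_of_abstain habs
  refine ⟨fun h => hx (hP h), ?_⟩
  refine (card_infers_le_drop hσ hc (labeledBy_seen _ c adv p t) hx hP).trans_lt ?_
  refine add_lt_add_of_lt_of_le (hdrop _) (mul_le_mul_of_nonneg_left ?_ (Nat.cast_nonneg _))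
  exact Nat.cast_le.2 (Nat.choose_le_choose i ((card_seen_le _ c adv p t).trans htT))

end Runs

/-! ### At most a few points of a sample are rarely inferred. -/

section Counting

variable {X : Type u}

open Classical in
/-- Among `w 0, …, w i`, the point `w l` is isolated and fewer than `β` of the `j`-sets of other
points infer it. -/
def IsRarelyInferred (C : Set (Concept X)) (F : Concept X → X → ℝ) (c : Concept X) (j : ℕ) (β : ℝ)
    (i l : ℕ) (w : ℕ → X) : Prop :=
  w l ∉ ((Finset.range (i + 1)).erase l).image w ∧
    ((((((Finset.range (i + 1)).erase l).image w).powersetCard j).filter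
      fun Q => Infers C F Q (w l) c).card : ℝ) < β

open Classical in
-- Double counting: every `(j + 1)`-set of rarely inferred points contains a point inferred by the
-- other `j`, while each point is charged by fewer than `β` such sets.
theorem choose_card_rarelyInferred_le {C : Set (Concept X)} {F : Concept X → X → ℝ}
    {c : Concept X} {j : ℕ} {β : ℝ} (hI : InferenceProperty C F (j + 1)) (hc : c ∈ C) (i : ℕ)
    (w : ℕ → X) :
    ((((Finset.range (i + 1)).filter fun l => IsRarelyInferred C F c j β i l w).card.choose (j + 1)
      : ℕ) : ℝ) ≤
      ((Finset.range (i + 1)).filter fun l => IsRarelyInferred C F c j β i l w).card * β := by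
  set B := (Finset.range (i + 1)).filter fun l => IsRarelyInferred C F c j β i l w with hB
  -- Isolation rules out repeated draws, so indices may be counted as points.
  have hinj : Set.InjOn w B := by
    intro l hl m hm hlm
    by_contra hne
    have h1 := (Finset.mem_filter.1 (Finset.mem_coe.1 hl)).2.1
    have h2 := (Finset.mem_filter.1 (Finset.mem_coe.1 hm)).1
    exact h1 (Finset.mem_image.2 ⟨m, Finset.mem_erase.2 ⟨fun h => hne h.symm, h2⟩, hlm.symm⟩)
  let N : ℕ → Finset (Finset X) := fun l =>
    (((((Finset.range (i + 1)).erase l).image w).powersetCard j).filter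
      fun Q => Infers C F Q (w l) c)
  have hsub : (B.image w).powersetCard (j + 1) ⊆
      B.biUnion fun l => (N l).image (insert (w l)) := by
    intro M hM
    obtain ⟨hMB, hMcard⟩ := Finset.mem_powersetCard.1 hM
    obtain ⟨x, hx, hinf⟩ := hI M hMcard c hc
    obtain ⟨l, hl, rfl⟩ := Finset.mem_image.1 (hMB hx)
    refine Finset.mem_biUnion.2 ⟨l, hl, Finset.mem_image.2 ⟨M.erase (w l), ?_,
      Finset.insert_erase hx⟩⟩
    refine Finset.mem_filter.2 ⟨Finset.mem_powersetCard.2 ⟨fun a ha => ?_, ?_⟩, by convert hinf⟩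
    · obtain ⟨hne, haM⟩ := Finset.mem_erase.1 ha
      obtain ⟨m, hm, rfl⟩ := Finset.mem_image.1 (hMB haM)
      exact Finset.mem_image.2 ⟨m, Finset.mem_erase.2
        ⟨fun h => hne (by rw [h]), (Finset.mem_filter.1 hm).1⟩, rfl⟩
    · rw [Finset.card_erase_of_mem hx, hMcard, Nat.add_sub_cancel]
  have h1 : (B.card.choose (j + 1)) ≤ ∑ l ∈ B, (N l).card := by
    calc B.card.choose (j + 1) = ((B.image w).powersetCard (j + 1)).card := by
          rw [Finset.card_powersetCard, Finset.card_image_of_injOn hinj]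
      _ ≤ _ := Finset.card_le_card hsub
      _ ≤ ∑ l ∈ B, ((N l).image (insert (w l))).card := Finset.card_biUnion_le
      _ ≤ _ := Finset.sum_le_sum fun l _ => Finset.card_image_le
  calc ((B.card.choose (j + 1) : ℕ) : ℝ) ≤ ((∑ l ∈ B, (N l).card : ℕ) : ℝ) := Nat.cast_le.2 h1
    _ = ∑ l ∈ B, ((N l).card : ℝ) := Nat.cast_sum _ _
    _ ≤ ∑ _l ∈ B, β := Finset.sum_le_sum fun l hl => (Finset.mem_filter.1 hl).2.2.le
    _ = B.card * β := by rw [Finset.sum_const, nsmul_eq_mul]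

/-- The swap keeps the sample `w 0, …, w i` and only changes which draw is the distinguished one. -/
theorem isRarelyInferred_of_swap {C : Set (Concept X)} {F : Concept X → X → ℝ} {c : Concept X}
    {j : ℕ} {β : ℝ} {i l : ℕ} (hl : l ≤ i) {w : ℕ → X}
    (h : IsRarelyInferred C F c j β i i (w ∘ Equiv.swap l i)) :
    IsRarelyInferred C F c j β i l w := by
  classical
  have himg : ((Finset.range (i + 1)).erase i).image (w ∘ Equiv.swap l i) =
      ((Finset.range (i + 1)).erase l).image w := by
    rw [← Finset.image_image]
    congr 1
    ext m
    simp only [Finset.mem_image, Finset.mem_erase, Finset.mem_range]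
    constructor
    · rintro ⟨a, ⟨ha, ha'⟩, rfl⟩
      rcases eq_or_ne a l with rfl | hal
      · rw [Equiv.swap_apply_left]; omega
      · rw [Equiv.swap_apply_of_ne_of_ne hal ha]; omega
    · rintro ⟨hm, hm'⟩
      rcases eq_or_ne m i with rfl | hmi
      · exact ⟨l, by omega, Equiv.swap_apply_left _ _⟩
      · exact ⟨m, by omega, Equiv.swap_apply_of_ne_of_ne hm hmi⟩
  unfold IsRarelyInferred at h ⊢
  convert h using 3 <;> first | rw [← himg] | skip
  all_goals simp [Equiv.swap_apply_right]

/-- Cancelling `b` leaves a bound on a binomial coefficient of order `j`, which is at least a `j`-th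
power over `j!`; taking roots bounds `b`. -/
theorem le_of_choose_le {b j : ℕ} {β Z : ℝ} (hj : j ≠ 0) (hZ : 0 ≤ Z)
    (h : ((b.choose (j + 1) : ℕ) : ℝ) ≤ b * β) (hβ : (j + 1).factorial * β ≤ Z ^ j) :
    (b : ℝ) ≤ j + Z := by
  rcases b with _ | b
  · rw [Nat.cast_zero]; positivity
  have h1 : ((b : ℝ) + 1) * (b.choose j : ℕ) = ((b + 1).choose (j + 1) : ℕ) * ((j : ℝ) + 1) := by
    exact_mod_cast Nat.add_one_mul_choose_eq b j
  have h2 : ((b.choose j : ℕ) : ℝ) ≤ (j + 1) * β := by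
    have hb : (0 : ℝ) < b + 1 := by positivity
    refine le_of_mul_le_mul_left ?_ hb
    rw [h1]
    push_cast at h
    nlinarith [mul_le_mul_of_nonneg_right h (by positivity : (0 : ℝ) ≤ (j : ℝ) + 1)]
  have h3 := (Nat.pow_le_choose (α := ℝ) j b).trans h2
  rw [div_le_iff₀ (by positivity)] at h3
  have h4 : ((b + 1 - j : ℕ) : ℝ) ^ j ≤ Z ^ j := by
    refine (by exact_mod_cast h3 : ((b + 1 - j : ℕ) : ℝ) ^ j ≤ (j + 1) * β * j.factorial).trans ?_
    refine le_trans (le_of_eq ?_) hβ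
    rw [Nat.factorial_succ]; push_cast; ring
  have h5 : ((b + 1 - j : ℕ) : ℝ) ≤ Z := le_of_pow_le_pow_left₀ hj hZ h4
  have h6 : ((b + 1 : ℕ) : ℝ) ≤ (j + (b + 1 - j) : ℕ) := Nat.cast_le.2 (by omega)
  push_cast at h6 ⊢
  linarith

end Counting

/-! ### Reindexed streams of draws and symmetrization. -/

section Reindexing

/-- Reading the stream of draws in the rounds in `I` and unused draws elsewhere. -/
def streamIndex (T : ℕ) (I : Finset ℕ) (t : ℕ) : ℕ :=
  if t ∈ I then Nat.count (· ∈ I) t else T + t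

theorem streamIndex_injective {T : ℕ} {I : Finset ℕ} (hI : I ⊆ Finset.range T) :
    Function.Injective (streamIndex T I) := by
  have hlt : ∀ t ∈ I, Nat.count (· ∈ I) t < T := fun t ht =>
    (Nat.count_le _).trans_lt (Finset.mem_range.1 (hI ht))
  intro s t hst
  unfold streamIndex at hst
  split_ifs at hst with hs ht ht
  · exact Nat.count_injective hs ht hst
  · have := hlt s hs; omega
  · have := hlt t ht; omega
  · omega

theorem exists_count_eq (I : Finset ℕ) {t m : ℕ} (h : m < Nat.count (· ∈ I) t) :
    ∃ s < t, s ∈ I ∧ Nat.count (· ∈ I) s = m := by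
  induction t with
  | zero => simp at h
  | succ t ih =>
    by_cases hm : m < Nat.count (· ∈ I) t
    · obtain ⟨s, hs, hs'⟩ := ih hm
      exact ⟨s, hs.trans t.lt_succ_self, hs'⟩
    · rw [Nat.count_succ] at h
      split_ifs at h with ht
      · exact ⟨t, t.lt_succ_self, ht, by omega⟩
      · omega

variable {X : Type u} {R : Type v} [MeasurableSpace X] [MeasurableSpace R]

/-- Distinct coordinates of an i.i.d. sequence are again i.i.d.; it suffices to compare finite
boxes. -/
theorem measurePreserving_comp_injective (D : Measure X) [IsProbabilityMeasure D] {g : ℕ → ℕ}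
    (hg : Function.Injective g) :
    MeasurePreserving (fun w : ℕ → X => w ∘ g) (Measure.infinitePi fun _ : ℕ => D)
      (Measure.infinitePi fun _ : ℕ => D) := by
  classical
  have hm : Measurable fun w : ℕ → X => w ∘ g :=
    measurable_pi_lambda _ fun n => measurable_pi_apply _
  refine ⟨hm, Measure.eq_infinitePi _ fun s t ht => ?_⟩
  rw [Measure.map_apply hm (MeasurableSet.pi s.countable_toSet fun n _ => ht n)]
  have hpre : (fun w : ℕ → X => w ∘ g) ⁻¹' Set.pi ↑s t =
      Set.pi ↑(s.image g) fun n => t (Function.invFun g n) := by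
    ext w
    simp only [Set.mem_preimage, Set.mem_pi, Finset.mem_coe, Finset.mem_image, Function.comp_apply]
    constructor
    · rintro h _ ⟨n, hn, rfl⟩
      rw [Function.leftInverse_invFun hg]
      exact h n hn
    · intro h n hn
      have := h (g n) ⟨n, hn, rfl⟩
      rwa [Function.leftInverse_invFun hg] at this
  rw [hpre, Measure.infinitePi_pi _ fun n _ => ht _, Finset.prod_image hg.injOn]
  simp only [Function.leftInverse_invFun hg _]

theorem measurePreserving_law (μ : Measure R) [IsProbabilityMeasure μ] (D : Measure X)
    [IsProbabilityMeasure D] {g : ℕ → ℕ} (hg : Function.Injective g) :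
    MeasurePreserving (Prod.map id fun w : ℕ → X => w ∘ g) (law μ D) (law μ D) :=
  (MeasurePreserving.id μ).prod (measurePreserving_comp_injective D hg)

instance isProbabilityMeasure_law (μ : Measure R) [IsProbabilityMeasure μ] (D : Measure X)
    [IsProbabilityMeasure D] : IsProbabilityMeasure (law μ D) := by
  unfold law; infer_instance

open Classical in
/-- The symmetrization bound: an event on which the `i`-th draw has a property that at most `b` of
the first `i + 1` draws can have has probability at most `b / (i + 1)`. The property itself need
not be measurable. -/
theorem measureReal_le_of_exchangeable (μ : Measure R) [IsProbabilityMeasure μ] (D : Measure X)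
    [IsProbabilityMeasure D] (i : ℕ) {B : Set (R × (ℕ → X))} (hB : MeasurableSet B)
    (E : ℕ → (ℕ → X) → Prop) (hBE : ∀ ω ∈ B, E i ω.2)
    (hswap : ∀ l ≤ i, ∀ w, E i (w ∘ Equiv.swap l i) → E l w) (b : ℝ)
    (hb : ∀ w, (((Finset.range (i + 1)).filter fun l => E l w).card : ℝ) ≤ b) :
    (law μ D).real B ≤ b * (1 / ((i : ℝ) + 1)) := by
  let S : ℕ → Set (R × (ℕ → X)) := fun l =>
    (Prod.map id fun w : ℕ → X => w ∘ Equiv.swap l i) ⁻¹' B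
  have hmp := fun l => measurePreserving_law μ D (Equiv.swap l i).injective
  have hS : ∀ l, MeasurableSet (S l) := fun l => (hmp l).measurable hB
  have hSB : ∀ l, (law μ D).real (S l) = (law μ D).real B := fun l =>
    (hmp l).measureReal_preimage hB.nullMeasurableSet
  have hint : ∀ l, Integrable ((S l).indicator (1 : R × (ℕ → X) → ℝ)) (law μ D) := fun l =>
    (integrable_const (1 : ℝ)).indicator (hS l)
  -- Each swap preserves the law, so `i + 1` times the probability is the expected number of `l`
  -- whose swapped stream lies in `B`.
  have hsum : ((i : ℝ) + 1) * (law μ D).real B =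
      ∫ ω, ∑ l ∈ Finset.range (i + 1), (S l).indicator (1 : R × (ℕ → X) → ℝ) ω ∂(law μ D) := by
    rw [integral_finsetSum _ fun l _ => hint l]
    simp only [integral_indicator_one (hS _), hSB]
    simp
  have hle : ∫ ω, ∑ l ∈ Finset.range (i + 1), (S l).indicator (1 : R × (ℕ → X) → ℝ) ω ∂(law μ D)
      ≤ ∫ _ω, b ∂(law μ D) := by
    refine integral_mono (integrable_finsetSum _ fun l _ => hint l) (integrable_const b)
      fun ω => le_trans ?_ (hb ω.2)
    -- Pointwise, a swapped stream in `B` forces `E l`. Only `B` and its preimages are integrated,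
    -- so `E` itself is never measured.
    rw [Finset.card_filter, Nat.cast_sum]
    refine Finset.sum_le_sum fun l hl => ?_
    by_cases hω : ω ∈ S l
    · have : E l ω.2 := hswap l (Nat.lt_succ_iff.1 (Finset.mem_range.1 hl)) _ (hBE _ hω)
      simp [hω, this]
    · rw [Set.indicator_of_notMem hω]
      positivity
  rw [integral_const, probReal_univ, one_smul] at hle
  rw [mul_one_div, le_div_iff₀ (by positivity), mul_comm, hsum]
  exact hle

end Reindexing

/-! ### Patterns of i.i.d. rounds under an adaptive adversary. -/

section Patterns

variable {X : Type u} {R : Type v}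
variable (learner : Finset (Labeled X) → X → Option ℤˣ) (c : Concept X) (adv : Adversary R X)

/-- The rounds in `I` are exactly those among the first `T` in which nature draws the instance. -/
def HasPattern (T : ℕ) (I : Finset ℕ) (ω : R × (ℕ → X)) : Prop :=
  ∀ t < T, (roundAt learner c adv t ω).injected = false ↔ t ∈ I

/-- The run reading the stream of draws `ω.2` along the pattern `I`. -/
def streamAlong (T : ℕ) (I : Finset ℕ) (ω : R × (ℕ → X)) : R × (ℕ → X) :=
  Prod.map id (fun w : ℕ → X => w ∘ streamIndex T I) ω

variable {learner c adv}

theorem count_congr_of_lt {I I' : Finset ℕ} {t : ℕ} (h : ∀ s < t, s ∈ I ↔ s ∈ I') :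
    Nat.count (· ∈ I) t = Nat.count (· ∈ I') t := by
  rw [Nat.count_eq_card_filter_range, Nat.count_eq_card_filter_range]
  congr 1
  exact Finset.filter_congr fun s hs => h s (Finset.mem_range.1 hs)

/-- Induction on rounds: equal histories give the same hidden bit. On an i.i.d. round both runs read
the stream at the number of earlier i.i.d. rounds, which agrees; on an injected round the draw is
not used. -/
theorem history_streamAlong_eq {T : ℕ} {I I' : Finset ℕ} {ω : R × (ℕ → X)}
    (hI : HasPattern learner c adv T I (streamAlong T I ω))
    (hI' : HasPattern learner c adv T I' (streamAlong T I' ω)) (t : ℕ) (ht : t ≤ T) :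
    history learner c adv (streamAlong T I ω) t = history learner c adv (streamAlong T I' ω) t ∧
      ∀ s < t, s ∈ I ↔ s ∈ I' := by
  induction t with
  | zero => exact ⟨rfl, fun s hs => absurd hs (Nat.not_lt_zero s)⟩
  | succ t ih =>
    obtain ⟨hh, hs⟩ := ih (Nat.le_of_succ_le ht)
    have h1 : adv.bit ω.1 (history learner c adv (streamAlong T I ω) t) = false ↔ t ∈ I :=
      hI t ht
    have h2 : adv.bit ω.1 (history learner c adv (streamAlong T I' ω) t) = false ↔ t ∈ I' :=
      hI' t ht
    have hmem : t ∈ I ↔ t ∈ I' := by rw [← h1, ← h2, hh]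
    refine ⟨?_, fun s hst => ?_⟩
    · have hx : ∀ J, (streamAlong T J ω).1 = ω.1 := fun _ => rfl
      simp only [history, playRound, hx, hh]
      cases hq : adv.bit ω.1 (history learner c adv (streamAlong T I' ω) t) with
      | true => simp
      | false =>
        have htI' := h2.1 hq
        have hw : (streamAlong T I ω).2 t = (streamAlong T I' ω).2 t := by
          simp only [streamAlong, Prod.map_snd, Function.comp_apply, streamIndex,
            if_pos htI', if_pos (hmem.2 htI'), count_congr_of_lt hs]
        simp [hw]
    · rcases Nat.lt_succ_iff_lt_or_eq.1 hst with h | rfl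
      · exact hs s h
      · exact hmem

theorem pattern_unique {T : ℕ} {I I' : Finset ℕ} (hIT : I ⊆ Finset.range T)
    (hIT' : I' ⊆ Finset.range T) {ω : R × (ℕ → X)}
    (hI : HasPattern learner c adv T I (streamAlong T I ω))
    (hI' : HasPattern learner c adv T I' (streamAlong T I' ω)) : I = I' := by
  have := (history_streamAlong_eq hI hI' T le_rfl).2
  ext t
  constructor
  · exact fun h => (this t (Finset.mem_range.1 (hIT h))).1 h
  · exact fun h => (this t (Finset.mem_range.1 (hIT' h))).2 h

theorem x_streamAlong {T : ℕ} {I : Finset ℕ} {ω : R × (ℕ → X)}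
    (hI : HasPattern learner c adv T I (streamAlong T I ω)) {t : ℕ} (ht : t < T) (htI : t ∈ I) :
    (roundAt learner c adv t (streamAlong T I ω)).x = ω.2 (Nat.count (· ∈ I) t) := by
  have h : adv.bit (streamAlong T I ω).1 (history learner c adv (streamAlong T I ω) t) = false :=
    (hI t ht).2 htI
  simp only [roundAt, playRound, h]
  simp [streamAlong, streamIndex, htI]

open Classical in
theorem image_subset_points_streamAlong {T : ℕ} {I : Finset ℕ} {ω : R × (ℕ → X)}
    (hI : HasPattern learner c adv T I (streamAlong T I ω)) {t : ℕ} (ht : t < T) :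
    (Finset.range (Nat.count (· ∈ I) t)).image ω.2 ⊆
      points (seen (history learner c adv (streamAlong T I ω) t)) := by
  intro x hx
  obtain ⟨m, hm, rfl⟩ := Finset.mem_image.1 hx
  obtain ⟨s, hst, hsI, rfl⟩ := exists_count_eq I (Finset.mem_range.1 hm)
  rw [← x_streamAlong hI (hst.trans ht) hsI]
  exact mem_points_seen learner c adv _ hst

end Patterns

/-! ### Expected number of abstentions. -/

section Abstentions

variable {X : Type u} {R : Type v}
variable {learner : Finset (Labeled X) → X → Option ℤˣ} {c : Concept X} {adv : Adversary R X}

/-- The event of an abstention on an i.i.d. round. -/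
def abstainEvent (learner : Finset (Labeled X) → X → Option ℤˣ) (c : Concept X)
    (adv : Adversary R X) (t : ℕ) : Set (R × (ℕ → X)) :=
  {ω | (roundAt learner c adv t ω).yhat = none ∧ (roundAt learner c adv t ω).injected = false}

theorem exists_hasPattern (T : ℕ) (ω : R × (ℕ → X)) :
    ∃ I ∈ (Finset.range T).powerset, HasPattern learner c adv T I ω := by
  classical
  refine ⟨(Finset.range T).filter fun t => (roundAt learner c adv t ω).injected = false,
    Finset.mem_powerset.2 (Finset.filter_subset _ _), fun t ht => ?_⟩
  simp [ht]

theorem errAbs_eq_sum_indicator (T : ℕ) (ω : R × (ℕ → X)) : errAbs learner c adv T ω =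
    ∑ t ∈ Finset.range T, (abstainEvent learner c adv t).indicator (1 : R × (ℕ → X) → ℝ) ω := by
  classical
  unfold errAbs abstainEvent
  refine Finset.sum_congr rfl fun t _ => ?_
  simp [Set.indicator_apply]

variable [MeasurableSpace X] [MeasurableSpace R]

theorem measurableSet_abstainEvent {T : ℕ} (hrun : IsMeasurableRun learner c adv T) {t : ℕ}
    (ht : t < T) : MeasurableSet (abstainEvent learner c adv t) := by
  have := @hrun t ht {a | a.2.1 = none ∧ a.1 = false} trivial
  exact this

theorem measurableSet_hasPattern {T : ℕ} (hrun : IsMeasurableRun learner c adv T)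
    (I : Finset ℕ) : MeasurableSet {ω | HasPattern learner c adv T I ω} := by
  have heq : {ω | HasPattern learner c adv T I ω} =
      ⋂ t ∈ Finset.range T,
        {ω | (roundAt learner c adv t ω).injected = false ↔ t ∈ I} := by
    ext ω; simp [HasPattern]
  rw [heq]
  refine Finset.measurableSet_biInter _ fun t ht => ?_
  have := @hrun t (Finset.mem_range.1 ht) {a | a.1 = false ↔ t ∈ I} trivial
  exact this

theorem integrable_errAbs (μ : Measure R) [IsProbabilityMeasure μ] (D : Measure X)
    [IsProbabilityMeasure D] {T : ℕ} (hrun : IsMeasurableRun learner c adv T) :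
    Integrable (errAbs learner c adv T) (law μ D) := by
  rw [funext (errAbs_eq_sum_indicator (learner := learner) (c := c) (adv := adv) T)]
  exact integrable_finsetSum _ fun t ht => (integrable_const (1 : ℝ)).indicator
    (measurableSet_abstainEvent hrun (Finset.mem_range.1 ht))

open Classical in
/-- If an abstention on the `i`-th i.i.d. round forces a property of the `i`-th draw that at most
`b` of the first `i + 1` draws can have, then there are at most `b * (1 + 1/2 + ⋯ + 1/T)`
such abstentions in expectation. -/
theorem integral_errAbs_le (μ : Measure R) [IsProbabilityMeasure μ] (D : Measure X)
    [IsProbabilityMeasure D] {T : ℕ} (hrun : IsMeasurableRun learner c adv T)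
    (E : ℕ → ℕ → (ℕ → X) → Prop)
    (hE : ∀ (I : Finset ℕ) (ω : R × (ℕ → X)),
      HasPattern learner c adv T I (streamAlong T I ω) → ∀ t < T, t ∈ I →
      (roundAt learner c adv t (streamAlong T I ω)).yhat = none →
      E (Nat.count (· ∈ I) t) (Nat.count (· ∈ I) t) ω.2)
    (hswap : ∀ i, ∀ l ≤ i, ∀ w, E i i (w ∘ Equiv.swap l i) → E i l w) (b : ℝ)
    (hb : ∀ i w, (((Finset.range (i + 1)).filter fun l => E i l w).card : ℝ) ≤ b) :
    ∫ ω, errAbs learner c adv T ω ∂(law μ D) ≤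
      b * ∑ i ∈ Finset.range T, 1 / ((i : ℝ) + 1) := by
  set P := law μ D with hP
  set A := abstainEvent learner c adv with hA
  let Q : Finset ℕ → Set (R × (ℕ → X)) := fun I => {ω | HasPattern learner c adv T I ω}
  have hAm : ∀ t < T, MeasurableSet (A t) := fun t ht => measurableSet_abstainEvent hrun ht
  have hQm : ∀ I, MeasurableSet (Q I) := measurableSet_hasPattern hrun
  let J : Finset (Finset ℕ × ℕ) :=
    ((Finset.range T).powerset ×ˢ Finset.range T).filter fun a => a.2 ∈ a.1
  -- All patterns are transported to one common stream, where the draw of round `t` is the one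
  -- numbered by the count of earlier rounds in the pattern.
  let G : Finset ℕ × ℕ → Set (R × (ℕ → X)) := fun a =>
    streamAlong T a.1 ⁻¹' (A a.2 ∩ Q a.1)
  have hJ : ∀ a ∈ J, a.1 ⊆ Finset.range T ∧ a.2 < T ∧ a.2 ∈ a.1 := fun a ha => by
    obtain ⟨h1, h2⟩ := Finset.mem_filter.1 ha
    obtain ⟨h3, h4⟩ := Finset.mem_product.1 h1
    exact ⟨Finset.mem_powerset.1 h3, Finset.mem_range.1 h4, h2⟩
  have hmp : ∀ a ∈ J, MeasurePreserving (streamAlong (R := R) (X := X) T a.1) P P := fun a ha =>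
    measurePreserving_law μ D (streamIndex_injective (hJ a ha).1)
  have hGm : ∀ a ∈ J, MeasurableSet (G a) := fun a ha =>
    (hmp a ha).measurable ((hAm _ (hJ a ha).2.1).inter (hQm _))
  have hint : ∫ ω, errAbs learner c adv T ω ∂P = ∑ t ∈ Finset.range T, P.real (A t) := by
    rw [funext (errAbs_eq_sum_indicator (learner := learner) (c := c) (adv := adv) T)]
    have hi : ∀ t ∈ Finset.range T, Integrable ((A t).indicator (1 : R × (ℕ → X) → ℝ)) P :=
      fun t ht => (integrable_const (1 : ℝ)).indicator (hAm t (Finset.mem_range.1 ht))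
    rw [integral_finsetSum _ hi]
    exact Finset.sum_congr rfl fun t ht => integral_indicator_one (hAm t (Finset.mem_range.1 ht))
  have hsplit : ∀ t ∈ Finset.range T, P.real (A t) ≤
      ∑ I ∈ (Finset.range T).powerset, if t ∈ I then P.real (G (I, t)) else 0 := by
    intro t ht
    have hcover : A t ⊆ ⋃ I ∈ (Finset.range T).powerset, A t ∩ Q I := by
      intro ω hω
      obtain ⟨I, hI, hpat⟩ := exists_hasPattern (learner := learner) (c := c) (adv := adv) T ω
      exact Set.mem_biUnion hI ⟨hω, hpat⟩
    refine (measureReal_mono hcover (measure_ne_top _ _)).trans ((measureReal_biUnion_finset_le _ _).trans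
      (Finset.sum_le_sum fun I hI => ?_))
    split_ifs with htI
    · have haJ : (I, t) ∈ J := Finset.mem_filter.2 ⟨Finset.mem_product.2 ⟨hI, ht⟩, htI⟩
      refine le_of_eq ((hmp _ haJ).measureReal_preimage ?_).symm
      exact ((hAm t (Finset.mem_range.1 ht)).inter (hQm I)).nullMeasurableSet
    · have : A t ∩ Q I = ∅ := Set.eq_empty_iff_forall_notMem.2 fun ω hω =>
        htI ((hω.2 t (Finset.mem_range.1 ht)).1 hω.1.2)
      rw [this, measureReal_empty]
  -- Pairs of pattern and round are regrouped by the number of the i.i.d. draw read there.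
  have hregroup : ∑ t ∈ Finset.range T, P.real (A t) ≤
      ∑ i ∈ Finset.range T, ∑ a ∈ J with Nat.count (· ∈ a.1) a.2 = i, P.real (G a) := by
    refine (Finset.sum_le_sum hsplit).trans (le_of_eq ?_)
    rw [Finset.sum_fiberwise_of_maps_to, Finset.sum_filter, Finset.sum_comm, Finset.sum_product]
    intro a ha
    exact Finset.mem_range.2 ((Nat.count_le _).trans_lt (hJ a ha).2.1)
  rw [hint, Finset.mul_sum]
  refine hregroup.trans (Finset.sum_le_sum fun i _ => ?_)
  -- The events in a group are disjoint: the stream and seed determine the pattern, and pattern and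
  -- count determine the round. So symmetrization is applied once per group, with no factor for the
  -- number of patterns.
  rw [← measureReal_biUnion_finset]
  · refine measureReal_le_of_exchangeable μ D i
      (Finset.measurableSet_biUnion _ fun a ha => hGm a (Finset.mem_filter.1 ha).1) (E i) ?_
      (hswap i) b (hb i)
    intro ω hω
    simp only [Set.mem_iUnion] at hω
    obtain ⟨a, ha, hωa⟩ := hω
    obtain ⟨haJ, rfl⟩ := Finset.mem_filter.1 ha
    obtain ⟨-, h2, h3⟩ := hJ a haJ
    exact hE a.1 ω hωa.2 a.2 h2 h3 hωa.1.1
  · intro a ha a' ha' hne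
    refine Set.disjoint_left.2 fun ω hω hω' => hne ?_
    obtain ⟨haJ, hai⟩ := Finset.mem_filter.1 (Finset.mem_coe.1 ha)
    obtain ⟨haJ', hai'⟩ := Finset.mem_filter.1 (Finset.mem_coe.1 ha')
    have hI : a.1 = a'.1 := pattern_unique (hJ a haJ).1 (hJ a' haJ').1 hω.2 hω'.2
    refine Prod.ext hI (Nat.count_injective (hJ a haJ).2.2 (hI ▸ (hJ a' haJ').2.2) ?_)
    rw [hai, ← hai', hI]
  · exact fun a ha => hGm a (Finset.mem_filter.1 ha).1

/-- The expected number of abstentions of the potential learner on i.i.d. rounds. -/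
theorem integral_errAbs_potentialLearner_le {C : Set (Concept X)} {F : Concept X → X → ℝ}
    {i n : ℕ} (hI : InferenceProperty C F (i + 2))
    {σ : Concept X → Finset (Labeled X) → Fin n} (hσ : EncodesTranscripts C F (i + 1) σ)
    {α : ℝ} {tie : Finset (Labeled X) → X → ℤˣ} (hc : c ∈ C)
    (μ : Measure R) [IsProbabilityMeasure μ] (D : Measure X) [IsProbabilityMeasure D] {T : ℕ}
    (hrun : IsMeasurableRun (potentialLearner C (i + 1) (certificateScore σ) α tie) c adv T)
    {Z : ℝ} (hZ : 0 ≤ Z)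
    (hβ : (i + 2).factorial * (α + n * T.choose i) ≤ Z ^ (i + 1)) :
    ∫ ω, errAbs (potentialLearner C (i + 1) (certificateScore σ) α tie) c adv T ω ∂(law μ D) ≤
      ((i + 1 : ℕ) + Z) * ∑ s ∈ Finset.range T, 1 / ((s : ℝ) + 1) := by
  classical
  refine integral_errAbs_le μ D hrun
    (IsRarelyInferred C F c (i + 1) (α + n * T.choose i)) ?_
    (fun s l hl w h => isRarelyInferred_of_swap hl h) _ fun s w => ?_
  · intro I ω hpat t ht htI habs
    have hsub := image_subset_points_streamAlong hpat ht
    have := card_infers_lt_of_abstain c adv (streamAlong T I ω) hσ hc ht.le habs hsub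
    rw [x_streamAlong hpat ht htI] at this
    have herase : (Finset.range (Nat.count (· ∈ I) t + 1)).erase (Nat.count (· ∈ I) t) =
        Finset.range (Nat.count (· ∈ I) t) := by
      ext m; simp only [Finset.mem_erase, Finset.mem_range]; omega
    unfold IsRarelyInferred
    convert this
  · exact le_of_choose_le (Nat.succ_ne_zero i) hZ (choose_card_rarelyInferred_le hI hc s w) hβ

end Abstentions

/-! ### Numerical bounds for the threshold. -/

section Bounds

theorem factorial_succ_le_pow (j : ℕ) : (j + 1).factorial ≤ (j + 1) ^ j := by
  induction j with
  | zero => simp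
  | succ j ih =>
    rw [Nat.factorial_succ, pow_succ']
    exact Nat.mul_le_mul_left _ (ih.trans (Nat.pow_le_pow_left (Nat.le_succ _) _))

theorem one_add_sq_le_five_pow (i : ℕ) : 1 + (i + 2) ^ 2 ≤ 5 ^ (i + 1) := by
  induction i with
  | zero => norm_num
  | succ i ih => rw [pow_succ' 5]; nlinarith

theorem sum_one_div_le (T : ℕ) : ∑ s ∈ Finset.range T, 1 / ((s : ℝ) + 1) ≤ 1 + Real.log T := by
  have := harmonic_le_one_add_log T
  simpa [harmonic] using this

/-- The choice of threshold: the numbers of sets counted by the potential against `y = T^(1-1/k)`,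
where `k = i + 2`. -/
theorem threshold_bounds (i T : ℕ) {y : ℝ} (hy1 : 1 ≤ y) (hyT : y ≤ T)
    (hy : y ^ (i + 2) = (T : ℝ) ^ (i + 1)) :
    ((2 ^ (i + 1) * (i + 2).factorial : ℕ) : ℝ) * T.choose (i + 1) ≤
        (2 * y) ^ (i + 1) * ((i + 2 : ℕ) * y) ∧
      ((i + 2).factorial : ℝ) *
          ((2 * y) ^ (i + 1) + ((2 ^ (i + 1) * (i + 2).factorial : ℕ) : ℝ) * T.choose i) ≤
        (10 * (i + 2 : ℕ) * y) ^ (i + 1) := by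
  have hy0 : 0 < y := by linarith
  have hT0 : (0 : ℝ) < T := by linarith
  have hfac : ((i + 2).factorial : ℝ) = (i + 2) * ((i + 1) * i.factorial) := by
    rw [Nat.factorial_succ, Nat.factorial_succ]; push_cast; ring
  have hc1 : ((T.choose (i + 1) : ℕ) : ℝ) * ((i + 1) * i.factorial) ≤ (T : ℝ) ^ (i + 1) := by
    have := Nat.choose_le_pow_div (α := ℝ) (i + 1) T
    rw [le_div_iff₀ (by positivity), Nat.factorial_succ] at this
    exact_mod_cast this
  have hc0 : ((T.choose i : ℕ) : ℝ) * i.factorial ≤ (T : ℝ) ^ i := by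
    have := Nat.choose_le_pow_div (α := ℝ) i T
    rwa [le_div_iff₀ (by positivity)] at this
  -- `T ^ i * T = y ^ (i + 1) * y`, and `y ≤ T`.
  have hTy : (T : ℝ) ^ i ≤ y ^ (i + 1) := by
    refine le_of_mul_le_mul_right ?_ hT0
    rw [← pow_succ, ← hy, pow_succ]
    exact mul_le_mul_of_nonneg_left hyT (by positivity)
  constructor
  · calc ((2 ^ (i + 1) * (i + 2).factorial : ℕ) : ℝ) * T.choose (i + 1)
        = 2 ^ (i + 1) * (i + 2) * (T.choose (i + 1) * ((i + 1) * i.factorial)) := by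
          rw [Nat.cast_mul, hfac]; push_cast; ring
      _ ≤ 2 ^ (i + 1) * (i + 2) * T ^ (i + 1) :=
          mul_le_mul_of_nonneg_left hc1 (by positivity)
      _ = (2 * y) ^ (i + 1) * ((i + 2 : ℕ) * y) := by
          rw [← hy]; push_cast; ring
  · have h5 : (1 : ℝ) + (i + 2) ^ 2 ≤ 5 ^ (i + 1) := by exact_mod_cast one_add_sq_le_five_pow i
    have hf : ((i + 2).factorial : ℝ) ≤ (i + 2) ^ (i + 1) := by
      exact_mod_cast factorial_succ_le_pow (i + 1)
    have hβ : (2 * y) ^ (i + 1) + ((2 ^ (i + 1) * (i + 2).factorial : ℕ) : ℝ) * T.choose i ≤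
        (2 * y) ^ (i + 1) * 5 ^ (i + 1) := by
      calc (2 * y) ^ (i + 1) + ((2 ^ (i + 1) * (i + 2).factorial : ℕ) : ℝ) * T.choose i
          = (2 * y) ^ (i + 1) + 2 ^ (i + 1) * ((i + 2) * (i + 1)) *
              (T.choose i * i.factorial) := by
            rw [Nat.cast_mul, hfac]; push_cast; ring
        _ ≤ (2 * y) ^ (i + 1) + 2 ^ (i + 1) * ((i + 2) * (i + 2)) * y ^ (i + 1) := by
            have := hc0.trans hTy
            gcongr
            norm_num
        _ = (2 * y) ^ (i + 1) * (1 + (i + 2) ^ 2) := by ring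
        _ ≤ _ := mul_le_mul_of_nonneg_left h5 (by positivity)
    -- The constant `10` is the `2` in the threshold times the `5` whose power absorbs `1 + k ^ 2`.
    calc _ ≤ ((i : ℝ) + 2) ^ (i + 1) * ((2 * y) ^ (i + 1) * 5 ^ (i + 1)) :=
          mul_le_mul hf hβ (by positivity) (by positivity)
      _ = (10 * (i + 2 : ℕ) * y) ^ (i + 1) := by
          rw [← mul_pow, ← mul_pow]; congr 1; push_cast; ring

end Bounds

/-! ### Combined error, and the degenerate case of dimension one. -/

section ErrorBound

variable {X : Type u} {R : Type v}

theorem errMis_nonneg (learner : Finset (Labeled X) → X → Option ℤˣ) (c : Concept X)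
    (adv : Adversary R X) (T : ℕ) (p : R × (ℕ → X)) : 0 ≤ errMis learner c adv T p :=
  Finset.sum_nonneg fun t _ => by dsimp only; split_ifs <;> norm_num

theorem errAbs_nonneg (learner : Finset (Labeled X) → X → Option ℤˣ) (c : Concept X)
    (adv : Adversary R X) (T : ℕ) (p : R × (ℕ → X)) : 0 ≤ errAbs learner c adv T p :=
  Finset.sum_nonneg fun t _ => by dsimp only; split_ifs <;> norm_num

theorem potentialLearner_eq_of_subsingleton {C : Set (Concept X)} {k : ℕ}
    {f : Finset (Labeled X) → Set (Concept X) → ℝ} {α : ℝ} {tie : Finset (Labeled X) → X → ℤˣ}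
    (hC : C.Subsingleton) {c : Concept X} (hc : c ∈ C) {S : Finset (Labeled X)}
    (hS : LabeledBy c ↑S) (x : X) : potentialLearner C k f α tie S x = some (c x) := by
  have hcV : c ∈ restrict (versionSpace C ↑S) x (c x) := ⟨⟨hc, hS⟩, rfl⟩
  have hempty : restrict (versionSpace C ↑S) x (-c x) = ∅ :=
    Set.eq_empty_iff_forall_notMem.2 fun h hh => by
      have : h = c := hC hh.1.1 hc
      exact units_neg_ne (c x) (by rw [← hh.2, this])
  unfold potentialLearner
  rcases Int.units_eq_one_or (c x) with h | h
  · rw [h] at hcV hempty ⊢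
    rw [if_neg (fun he => by rw [he] at hcV; exact hcV), if_pos hempty]
  · rw [h, neg_neg] at hempty
    rw [h, if_pos hempty]

theorem error_eq_zero_of_subsingleton {C : Set (Concept X)} {k : ℕ}
    {f : Finset (Labeled X) → Set (Concept X) → ℝ} {α : ℝ} {tie : Finset (Labeled X) → X → ℤˣ}
    (hC : C.Subsingleton) {c : Concept X} (hc : c ∈ C) (adv : Adversary R X) (T : ℕ)
    (ω : R × (ℕ → X)) : errMis (potentialLearner C k f α tie) c adv T ω +
      errAbs (potentialLearner C k f α tie) c adv T ω = 0 := by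
  have h : ∀ t, (roundAt (potentialLearner C k f α tie) c adv t ω).yhat =
      some (roundAt (potentialLearner C k f α tie) c adv t ω).y := fun t =>
    potentialLearner_eq_of_subsingleton hC hc (labeledBy_seen _ c adv ω t) _
  simp [errMis, errAbs, h]

/-- Each point is inferred by the empty set, whose transcript is the same for all concepts. -/
theorem subsingleton_of_inferenceProperty_one {C : Set (Concept X)} {F : Concept X → X → ℝ}
    (hI : InferenceProperty C F 1) : C.Subsingleton := by
  classical
  intro h hh h' hh'
  funext x
  obtain ⟨z, hz, hinf⟩ := hI {x} (Finset.card_singleton x) h' hh'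
  obtain rfl := Finset.mem_singleton.1 hz
  refine hinf h hh (Prod.ext (funext fun a => ?_) (funext fun a => ?_)) <;>
    exact absurd a.2 (by simp)

variable [MeasurableSpace X] [MeasurableSpace R]

theorem integral_error_le {C : Set (Concept X)} {F : Concept X → X → ℝ} {i : ℕ}
    (hI : InferenceProperty C F (i + 2))
    {σ : Concept X → Finset (Labeled X) → Fin (2 ^ (i + 1) * (i + 2).factorial)}
    (hσ : EncodesTranscripts C F (i + 1) σ) {T : ℕ} {y : ℝ} (hy1 : 1 ≤ y) (hyT : y ≤ T)
    (hy : y ^ (i + 2) = (T : ℝ) ^ (i + 1)) {tie : Finset (Labeled X) → X → ℤˣ} {c : Concept X}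
    (hc : c ∈ C) (μ : Measure R) [IsProbabilityMeasure μ] (D : Measure X) [IsProbabilityMeasure D]
    (adv : Adversary R X)
    (hrun : IsMeasurableRun
      (potentialLearner C (i + 1) (certificateScore σ) ((2 * y) ^ (i + 1)) tie) c adv T) :
    ∫ ω, (errMis (potentialLearner C (i + 1) (certificateScore σ) ((2 * y) ^ (i + 1)) tie) c adv T ω
        + errAbs (potentialLearner C (i + 1) (certificateScore σ) ((2 * y) ^ (i + 1)) tie) c adv T ω)
        ∂(law μ D) ≤ 12 * (i + 2 : ℕ) * y * (1 + Real.log T) := by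
  set L := potentialLearner C (i + 1) (certificateScore σ) ((2 * y) ^ (i + 1)) tie
  have hy0 : 0 < y := by linarith
  have hα : 0 < (2 * y) ^ (i + 1) := by positivity
  obtain ⟨hmis, habs⟩ := threshold_bounds i T hy1 hyT hy
  have hM : ∀ ω, errMis L c adv T ω ≤ (i + 2 : ℕ) * y := fun ω => by
    have h1 := potential_add_errMis_le (i := i) c adv ω σ ((2 * y) ^ (i + 1)) tie hc T
    have h2 := potential_nonneg C (i + 1) σ (seen (history L c adv ω T))
    refine le_of_mul_le_mul_left ?_ hα
    linarith
  have hA := integral_errAbs_potentialLearner_le hI hσ hc μ D hrun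
    (by positivity : 0 ≤ 10 * ((i + 2 : ℕ) : ℝ) * y) habs
  have hlog : 0 ≤ Real.log T := Real.log_nonneg (hy1.trans hyT)
  have hint := integrable_errAbs μ D hrun
  calc _ ≤ ∫ ω, ((i + 2 : ℕ) * y + errAbs L c adv T ω) ∂(law μ D) := by
        -- The misclassification count is bounded on every run, so only the abstention count has to
        -- be integrable.
        refine integral_mono_of_nonneg (Filter.Eventually.of_forall fun ω =>
          add_nonneg (errMis_nonneg L c adv T ω) (errAbs_nonneg L c adv T ω))
          ((integrable_const _).add hint) (Filter.Eventually.of_forall fun ω => ?_)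
        exact add_le_add_left (hM ω) _
    _ = (i + 2 : ℕ) * y + ∫ ω, errAbs L c adv T ω ∂(law μ D) := by
        rw [integral_add (integrable_const _) hint, integral_const, probReal_univ, one_smul]
    -- In units of `k * y`, mistakes contribute `1` and abstentions `1 + 10`, whence the constant
    -- `12`.
    _ ≤ (i + 2 : ℕ) * y * (1 + Real.log T) +
          (11 * ((i + 2 : ℕ) * y)) * (1 + Real.log T) := by
        refine add_le_add (le_mul_of_one_le_right (by positivity) (by linarith)) (hA.trans ?_)
        refine mul_le_mul ?_ (sum_one_div_le T) (Finset.sum_nonneg fun s _ => by positivity)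
          (by positivity)
        have h1 : ((i + 1 : ℕ) : ℝ) ≤ (i + 2 : ℕ) * y :=
          (Nat.cast_le.2 (Nat.le_succ _)).trans (le_mul_of_one_le_right (Nat.cast_nonneg _) hy1)
        linarith
    _ = _ := by ring

end ErrorBound

end AdversarialInjection

/-! ### The lemma itself. -/

theorem lemma5p2 :
    ∃ (K : ℝ) (p : ℕ), ∀ (X : Type u) [MeasurableSpace X] (C : Set (Concept X))
      (F : Concept X → X → ℝ) (k : ℕ),
      C.Nonempty → IsRepresentation C F → HasInferenceDimension C F k →
      ∃ n : ℕ, n ≤ 2 ^ (k - 1) * k.factorial ∧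
      ∃ σ : Concept X → Finset (Labeled X) → Fin n,
        IsCertificate C k k n σ ∧
        EncodesTranscripts C F (k - 1) σ ∧
        IsGood C k (2 ^ (k - 1) * k.factorial : ℝ) (k - 1) (certificateScore σ) ∧
        ∀ T : ℕ, 1 ≤ T → ∃ α : ℝ, 0 < α ∧
          ∀ (tie : Finset (Labeled X) → X → ℤˣ) (D : Measure X) [IsProbabilityMeasure D]
            (cstar : Concept X), cstar ∈ C →
          ∀ (R : Type v) [MeasurableSpace R] (μ : Measure R) [IsProbabilityMeasure μ]
            (adv : Adversary R X),
            IsMeasurableRun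
              (potentialLearner C (k - 1) (certificateScore σ) α tie) cstar adv T →
            ∫ ω, (errMis (potentialLearner C (k - 1) (certificateScore σ) α tie) cstar adv T ω
                + errAbs (potentialLearner C (k - 1) (certificateScore σ) α tie) cstar adv T ω)
                ∂(law μ D)
              ≤ K * k * (T : ℝ) ^ (1 - 1 / (k : ℝ)) * (1 + Real.log T) ^ p := by
  refine ⟨12, 1, fun X _ C F k hC _ hdim => ?_⟩
  have hI : InferenceProperty C F k := hdim.1
  rcases k with _ | j
  -- Dimension `0` is impossible: the empty set has no point to infer.
  · obtain ⟨h, hh⟩ := hC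
    obtain ⟨x, hx, -⟩ := hI ∅ Finset.card_empty h hh
    exact absurd hx (Finset.notMem_empty x)
  obtain ⟨σ, hσ⟩ := exists_encodesTranscripts C F j
  have hgood := EncodesTranscripts.isGood hI hσ
  push_cast at hgood
  refine ⟨2 ^ j * (j + 1).factorial, le_rfl, σ,
    EncodesTranscripts.isCertificate hI (Nat.succ_pos j) (Nat.mul_pos (by positivity)
      (Nat.factorial_pos _)) hσ, hσ, hgood, fun T hT => ?_⟩
  have hT' : (1 : ℝ) ≤ T := Nat.one_le_cast.2 hT
  rcases j with _ | i
  · have hsub := subsingleton_of_inferenceProperty_one hI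
    -- Any positive threshold works: with a single concept every prediction is forced and correct.
    refine ⟨1, one_pos, fun tie D _ c hc R _ μ _ adv _ => ?_⟩
    have hlog := Real.log_nonneg hT'
    simp only [error_eq_zero_of_subsingleton hsub hc, integral_zero]
    positivity
  · set y : ℝ := (T : ℝ) ^ (1 - 1 / ((i + 1 + 1 : ℕ) : ℝ)) with hydef
    have hk : (1 : ℝ) ≤ (i + 1 + 1 : ℕ) := by exact_mod_cast Nat.succ_pos (i + 1)
    have hk' : 1 / ((i + 1 + 1 : ℕ) : ℝ) ≤ 1 := (div_le_one (by linarith)).2 hk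
    have hy1 : 1 ≤ y := Real.one_le_rpow hT' (by linarith)
    have hyT : y ≤ T := by
      conv_rhs => rw [← Real.rpow_one (T : ℝ)]
      refine Real.rpow_le_rpow_of_exponent_le hT' ?_
      have : 0 ≤ 1 / ((i + 1 + 1 : ℕ) : ℝ) := by positivity
      linarith
    have hy : y ^ (i + 2) = (T : ℝ) ^ (i + 1) := by
      rw [hydef, ← Real.rpow_natCast, ← Real.rpow_mul (by linarith), ← Real.rpow_natCast]
      congr 1
      push_cast
      have : (i : ℝ) + 1 + 1 ≠ 0 := by positivity
      field_simp
      ring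
    refine ⟨(2 * y) ^ (i + 1), by positivity, fun tie D _ c hc R _ μ _ adv hrun => ?_⟩
    rw [pow_one]
    exact integral_error_le hI hσ hy1 hyT hy hc μ D adv hrun
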